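/- Let $n\ge 1$ and let $X=X^*\in M_n(\mathbb C)$. Write $\|A\|_\infty$ for the operator norm on $\mathbb C^n$, $\|Y\|_S=\sup\{\|Y\circ A\|_\infty : \|A\|_\infty\le 1\}$ for the Schur multiplier norm ($\circ$ is the entrywise product), and $\|X\|_{cbB}=\sup\{|\mathrm{Tr}(Y^*X)| : \|Y\|_S\le 1\}$ for its dual norm. Let $\mathcal S$ be the set of unit vectors of $\mathbb C^n$, let $P_\xi$ be the orthogonal projection onto $\mathbb C\xi$, and let $\Delta(\gamma)$ be the diagonal matrix with diagonal $\gamma$. Consider the linear program $$(\mathcal P):\quad \min\sum_{j=1}^n\lambda_j\quad\text{subject to } \lambda_j\ge 0 \text{ for all } j,\quad \pm\langle X\xi,\xi\rangle\le\sum_j\lambda_j|\xi_j|^2\text{ for all }\xi\in\mathcal S,$$ and its dual, with variables $(\mu_\xi)_{\xi\in\mathcal S}$ and $(\nu_\eta)_{\eta\in\mathcal S}$, $$(\mathcal P^*):\quad \max\Big(\sum_{\xi}\mu_\xi\langle X\xi,\xi\rangle-\sum_\eta\nu_\eta\langle X\eta,\eta\rangle\Big)\quad\text{subject to }\mu_\xi,\nu_\eta\ge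 0,\quad \sum_\xi\mu_\xi|\xi_j|^2+\sum_\eta\nu_\eta|\eta_j|^2\le 1\text{ for all }j.$$ A solution of $(\mathcal P^*)$ is called finite if only finitely many of its variables are nonzero. (1) The optimal value of $(\mathcal P)$ and of $(\mathcal P^*)$ is $\|X\|_{cbB}$; both optima are attained, that of $(\mathcal P^*)$ by a finite solution. (2) Call $X=\Delta(\eta)B\Delta(\xi)$ a cbB-factorization if $\eta_j,\xi_j\ge0$, $\|\eta\|_2=\|\xi\|_2=1$, $\|B\|_\infty=\|X\|_{cbB}$, the range of $B$ is contained in the support of $\Delta(\eta)$ and the support of $B$ is contained in the support of $\Delta(\xi)$. Such a factorization exists with $\eta=\xi$ and $B=B^*$, and it is the only one if $X\ne0$. For every cbB-factorization of $X$, $\lambda_j:=\|X\|_{cbB}\,\xi_j^2$ is an optimal solution of $(\mathcal P)$. (3) Let $Y=Y^*\in M_n(\mathbb C)$ satisfy $\|Y\|_S=1$ and $\mathrm{Tr}(YX)=\|X\|_{cbB}$, and let $Y=ESE$ be any self-adjoint Schur factorization, that is, $E\ge0$, $\mathrm{diag}(E^2)\le\|Y\|_S I$ and $S$ is a self-adjoint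 isometry. Put $F=\frac12(I+S)$ and $G=\frac12(I-S)$. Then there are spectral decompositions $EFE=\sum_{s}\mu_sP_{\xi_s}$ and $EGE=\sum_{t}\nu_tP_{\eta_t}$ with finite orthonormal sets $\{\xi_s\}$, $\{\eta_t\}$ and $\mu_s,\nu_t>0$, and for all such decompositions, setting $\mu_{\xi_s}=\mu_s$, $\nu_{\eta_t}=\nu_t$ and all other variables $0$ gives a finite optimal solution of $(\mathcal P^*)$, with value $\|X\|_{cbB}$. (4) Let $(\mu_\xi),(\nu_\eta)$ be any finite optimal solution of $(\mathcal P^*)$, and put $Z=\sum_\xi\mu_\xi P_\xi-\sum_\eta\nu_\eta P_\eta$. Then $\mathrm{Tr}(ZX)=\|X\|_{cbB}$, and if $X\neq0$ then $\|Z\|_S=1$ and also $\big\|\sum_\xi\mu_\xi P_\xi+\sum_\eta\nu_\eta P_\eta\big\|_S=1$. -/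

import Mathlib

open scoped Matrix ComplexOrder

namespace SchurLP

noncomputable section

/-- The operator norm of a complex `n × n` matrix acting on the Hilbert space `ℂⁿ`. -/
def opNorm {n : ℕ} (A : Matrix (Fin n) (Fin n) ℂ) : ℝ :=
  ‖Matrix.toEuclideanCLM (n := Fin n) (𝕜 := ℂ) A‖

/-- The Schur multiplier norm: the norm of `Y ↦ X ⊙ Y` (entrywise product) with respect to the
operator norm. -/
def schurNorm {n : ℕ} (X : Matrix (Fin n) (Fin n) ℂ) : ℝ :=
  sSup {r : ℝ | ∃ Y : Matrix (Fin n) (Fin n) ℂ, opNorm Y ≤ 1 ∧ r = opNorm (X ⊙ Y)}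

/-- The norm dual to the Schur multiplier norm under the pairing `Tr (Yᴴ X)`. -/
def cbBNorm {n : ℕ} (X : Matrix (Fin n) (Fin n) ℂ) : ℝ :=
  sSup {r : ℝ | ∃ Y : Matrix (Fin n) (Fin n) ℂ, schurNorm Y ≤ 1 ∧ r = ‖(Yᴴ * X).trace‖}

/-- The set of unit vectors of `ℂⁿ` with the Euclidean norm. -/
abbrev UnitVec (n : ℕ) : Type :=
  Metric.sphere (0 : EuclideanSpace ℂ (Fin n)) 1

/-- The coordinates of a unit vector. -/
def UnitVec.coord {n : ℕ} (ξ : UnitVec n) : Fin n → ℂ :=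
  WithLp.ofLp (ξ : EuclideanSpace ℂ (Fin n))

/-- `⟨X ξ, ξ⟩`, which is a real number when `X` is self-adjoint. -/
def quadForm {n : ℕ} (X : Matrix (Fin n) (Fin n) ℂ) (ξ : UnitVec n) : ℝ :=
  (star ξ.coord ⬝ᵥ (X *ᵥ ξ.coord)).re

/-- `P_ξ = ξ ξ*`, the orthogonal projection onto `ℂ ξ`, for a unit vector `ξ`. -/
def proj {n : ℕ} (ξ : UnitVec n) : Matrix (Fin n) (Fin n) ℂ :=
  Matrix.vecMulVec ξ.coord (star ξ.coord)

/-! The primal program -/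

/-- The constraints of the primal program. -/
structure PrimalFeasible {n : ℕ} (X : Matrix (Fin n) (Fin n) ℂ) (l : Fin n → ℝ) : Prop where
  nonneg : ∀ j, 0 ≤ l j
  upper : ∀ ξ : UnitVec n, quadForm X ξ ≤ ∑ j, l j * ‖ξ.coord j‖ ^ 2
  lower : ∀ η : UnitVec n, -quadForm X η ≤ ∑ j, l j * ‖η.coord j‖ ^ 2

/-- The values of the primal objective at feasible solutions. -/
def primalValues {n : ℕ} (X : Matrix (Fin n) (Fin n) ℂ) : Set ℝ :=
  {v | ∃ l : Fin n → ℝ, PrimalFeasible X l ∧ v = ∑ j, l j}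

/-- An optimal solution of the primal program. -/
def PrimalOptimal {n : ℕ} (X : Matrix (Fin n) (Fin n) ℂ) (l : Fin n → ℝ) : Prop :=
  PrimalFeasible X l ∧ ∀ l' : Fin n → ℝ, PrimalFeasible X l' → ∑ j, l j ≤ ∑ j, l' j

/-! The dual program -/

/-- The constraints of the dual program. The variables are indexed by all unit vectors, and
infinitely many of them may be nonzero, so finiteness of the sums is part of feasibility. -/
structure DualFeasible {n : ℕ} (μ ν : UnitVec n → ℝ) : Prop where
  nonneg_left : ∀ ξ, 0 ≤ μ ξ
  nonneg_right : ∀ η, 0 ≤ ν η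
  summable_left : ∀ j, Summable fun ξ : UnitVec n => μ ξ * ‖ξ.coord j‖ ^ 2
  summable_right : ∀ j, Summable fun η : UnitVec n => ν η * ‖η.coord j‖ ^ 2
  le_one : ∀ j, ∑' ξ : UnitVec n, μ ξ * ‖ξ.coord j‖ ^ 2
    + ∑' η : UnitVec n, ν η * ‖η.coord j‖ ^ 2 ≤ 1

/-- The dual objective. For feasible `μ, ν` both series converge absolutely, since adding the
constraints over `j` gives `∑ μ + ∑ ν ≤ n` and `ξ ↦ ⟨X ξ, ξ⟩` is bounded. -/
def dualValue {n : ℕ} (X : Matrix (Fin n) (Fin n) ℂ) (μ ν : UnitVec n → ℝ) : ℝ :=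
  ∑' ξ : UnitVec n, μ ξ * quadForm X ξ - ∑' η : UnitVec n, ν η * quadForm X η

/-- The values of the dual objective at feasible solutions. -/
def dualValues {n : ℕ} (X : Matrix (Fin n) (Fin n) ℂ) : Set ℝ :=
  {v | ∃ μ ν : UnitVec n → ℝ, DualFeasible μ ν ∧ v = dualValue X μ ν}

/-- An optimal solution of the dual program. -/
def DualOptimal {n : ℕ} (X : Matrix (Fin n) (Fin n) ℂ) (μ ν : UnitVec n → ℝ) : Prop :=
  DualFeasible μ ν ∧
    ∀ μ' ν' : UnitVec n → ℝ, DualFeasible μ' ν' → dualValue X μ' ν' ≤ dualValue X μ ν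

/-- Only finitely many variables are nonzero. -/
def FiniteSolution {n : ℕ} (μ ν : UnitVec n → ℝ) : Prop :=
  (Function.support μ).Finite ∧ (Function.support ν).Finite

/-- `∑ μ_ξ P_ξ`, for finitely supported `μ`. -/
def projSum {n : ℕ} (μ : UnitVec n → ℝ) : Matrix (Fin n) (Fin n) ℂ :=
  ∑ᶠ ξ : UnitVec n, (μ ξ : ℂ) • proj ξ

/-! Factorizations -/

/-- The diagonal matrix `Δ(γ)` of a real vector. -/
def diagMat {n : ℕ} (γ : Fin n → ℝ) : Matrix (Fin n) (Fin n) ℂ :=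
  Matrix.diagonal fun j => (γ j : ℂ)

/-- A cbB-factorization `X = Δ(η) B Δ(ξ)`, with `η, ξ` nonnegative unit vectors, `B` of operator
norm `‖X‖_cbB`, the range of `B` inside the support of `Δ(η)` and the support of `B` inside the
support of `Δ(ξ)`. -/
structure IsCbBFactorization {n : ℕ} (X : Matrix (Fin n) (Fin n) ℂ)
    (η : Fin n → ℝ) (B : Matrix (Fin n) (Fin n) ℂ) (ξ : Fin n → ℝ) : Prop where
  nonneg_left : ∀ i, 0 ≤ η i
  nonneg_right : ∀ j, 0 ≤ ξ j
  unit_left : ∑ i, η i ^ 2 = 1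
  unit_right : ∑ j, ξ j ^ 2 = 1
  factor : X = diagMat η * B * diagMat ξ
  norm_eq : opNorm B = cbBNorm X
  range_le : ∀ i j, η i = 0 → B i j = 0
  support_le : ∀ i j, ξ j = 0 → B i j = 0

/-- A self-adjoint Schur factorization `Y = E S E`: `E ≥ 0`, `diag (E²) ≤ ‖Y‖_S I`, and `S` is a
self-adjoint isometry. -/
structure IsSelfAdjointSchurFactorization {n : ℕ} (Y E S : Matrix (Fin n) (Fin n) ℂ) : Prop where
  posSemidef : E.PosSemidef
  diag_le : ∀ j, ((E * E) j j).re ≤ schurNorm Y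
  selfAdjoint : S.IsHermitian
  isometry : Sᴴ * S = 1
  factor : Y = E * S * E

/-- The projection `F = (I + S)/2` onto the eigenspace of `S` for the eigenvalue `1`. With
`G = (I - S)/2` one has `S = F - G`. -/
def posProj {n : ℕ} (S : Matrix (Fin n) (Fin n) ℂ) : Matrix (Fin n) (Fin n) ℂ :=
  (1 / 2 : ℂ) • (1 + S)

/-- The projection `G = (I - S)/2` onto the eigenspace of `S` for the eigenvalue `-1`. -/
def negProj {n : ℕ} (S : Matrix (Fin n) (Fin n) ℂ) : Matrix (Fin n) (Fin n) ℂ :=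
  (1 / 2 : ℂ) • (1 - S)

/-- `μ` records a spectral decomposition `A = ∑ μ_s P_{ξ_s}` with `(ξ_s)` a finite orthonormal
set and all `μ_s > 0`; the variables of the remaining unit vectors are zero. -/
structure IsSpectralDecomposition {n : ℕ} (A : Matrix (Fin n) (Fin n) ℂ)
    (μ : UnitVec n → ℝ) : Prop where
  nonneg : ∀ ξ, 0 ≤ μ ξ
  finite : (Function.support μ).Finite
  orthonormal : Orthonormal ℂ
    fun ξ : Function.support μ => ((ξ : UnitVec n) : EuclideanSpace ℂ (Fin n))
  eq_sum : A = projSum μ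

end

end SchurLP

namespace SchurLP

open Matrix

variable {n : ℕ}

/-! Three quantities are squeezed together. A primal feasible `l` gives `X = Δ(√l) T Δ(√l)` with `T`
a contraction (`PrimalFeasible.factor`, `PrimalFeasible.opNorm_normalized_le`), so the cbB-norm is
at most `∑ l j` by `cbBNorm_le`. A finite dual solution is a pair of positive semidefinite `M, N`
with `diag (M + N) ≤ 1` and value `Tr ((M - N) X)`; a Gram representation shows that `M - N` has
Schur norm at most one (`schurNorm_sub_le`), so the value is at most the cbB-norm. By compactness
the maximum `D` over such pairs is attained, and separating a convex set of slack vectors from the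
negative orthant yields a primal solution of value exactly `D` (`exists_primalFeasible`). Hence all
three agree. Only the easy half of the Gram characterization of Schur multipliers is needed.

Uniqueness of the factorization rests on a Heinz inequality (`opNorm_sqrt_sq_le`): the entrywise
geometric means of the outer vectors of two factorizations again factor `X`, with a middle matrix of
norm at most the cbB-norm, and the equality case of Cauchy–Schwarz makes the outer vectors equal.
Since `X` is Hermitian, the adjoint of a factorization is another one, so the two outer vectors
coincide.

For a self-adjoint Schur factorization, `EFE + EGE = E²` gives dual feasibility and `EFE - EGE = Y`
gives the value. Conversely, an optimal pair `M, N` norms `X`, which forces the Schur norms to be at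
least one. -/

/-! ### Operator norm estimates and Schur multipliers -/

lemma inner_toLp_mulVec (A : Matrix (Fin n) (Fin n) ℂ) (u v : Fin n → ℂ) :
    star v ⬝ᵥ (A *ᵥ u) = inner ℂ (WithLp.toLp 2 v)
      (Matrix.toEuclideanCLM (n := Fin n) (𝕜 := ℂ) A (WithLp.toLp 2 u)) := by
  rw [Matrix.toEuclideanCLM_toLp, EuclideanSpace.inner_toLp_toLp, dotProduct_comm]

lemma norm_toLp_sq (u : Fin n → ℂ) : ‖WithLp.toLp 2 u‖ ^ 2 = ∑ j, ‖u j‖ ^ 2 := by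
  rw [EuclideanSpace.norm_sq_eq]

lemma opNorm_nonneg (A : Matrix (Fin n) (Fin n) ℂ) : 0 ≤ opNorm A := norm_nonneg _

lemma norm_dotProduct_mulVec_le (A : Matrix (Fin n) (Fin n) ℂ) (u v : Fin n → ℂ) :
    ‖star v ⬝ᵥ (A *ᵥ u)‖ ≤ opNorm A * (‖WithLp.toLp 2 u‖ * ‖WithLp.toLp 2 v‖) := by
  rw [inner_toLp_mulVec]
  refine (norm_inner_le_norm _ _).trans ?_
  have := ContinuousLinearMap.le_opNorm (Matrix.toEuclideanCLM (n := Fin n) (𝕜 := ℂ) A)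
    (WithLp.toLp 2 u)
  calc _ ≤ ‖WithLp.toLp 2 v‖ * (opNorm A * ‖WithLp.toLp 2 u‖) := by
        unfold opNorm; gcongr
    _ = _ := by ring

lemma re_dotProduct_mulVec_le (A : Matrix (Fin n) (Fin n) ℂ) (u v : Fin n → ℂ) :
    (star v ⬝ᵥ (A *ᵥ u)).re ≤ opNorm A / 2 * (∑ j, ‖u j‖ ^ 2 + ∑ j, ‖v j‖ ^ 2) := by
  refine (Complex.re_le_norm _).trans ((norm_dotProduct_mulVec_le A u v).trans ?_)
  rw [← norm_toLp_sq, ← norm_toLp_sq]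
  nlinarith [mul_nonneg (opNorm_nonneg A) (sq_nonneg (‖WithLp.toLp 2 u‖ - ‖WithLp.toLp 2 v‖))]

lemma opNorm_le_of_re_le (A : Matrix (Fin n) (Fin n) ℂ) {c : ℝ} (hc : 0 ≤ c)
    (h : ∀ u v : Fin n → ℂ,
      (star v ⬝ᵥ (A *ᵥ u)).re ≤ c / 2 * (∑ j, ‖u j‖ ^ 2 + ∑ j, ‖v j‖ ^ 2)) :
    opNorm A ≤ c := by
  refine ContinuousLinearMap.opNorm_le_bound _ hc fun x => ?_
  set y := Matrix.toEuclideanCLM (n := Fin n) (𝕜 := ℂ) A x with hy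
  rcases eq_or_ne y 0 with h0 | h0
  · rw [h0, norm_zero]; positivity
  have hy0 : 0 < ‖y‖ := norm_pos_iff.2 h0
  have hx0 : 0 < ‖x‖ := by
    refine norm_pos_iff.2 fun hx => h0 ?_
    rw [hy, hx, map_zero]
  -- Rescaling `y = A x` to the norm of `x` makes the arithmetic-geometric mean bound tight.
  have key := h (WithLp.ofLp x) (WithLp.ofLp (((‖x‖ / ‖y‖ : ℝ) : ℂ) • y))
  rw [inner_toLp_mulVec, ← norm_toLp_sq, ← norm_toLp_sq, WithLp.toLp_ofLp, WithLp.toLp_ofLp,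
    ← hy, inner_smul_left, inner_self_eq_norm_sq_to_K, norm_smul, Complex.norm_real,
    Complex.conj_ofReal, Real.norm_of_nonneg (by positivity), div_mul_cancel₀ _ hy0.ne'] at key
  have e : ((((‖x‖ / ‖y‖ : ℝ) : ℂ)) * ((‖y‖ : ℂ)) ^ 2).re = ‖x‖ * ‖y‖ := by
    rw [← Complex.ofReal_pow, ← Complex.ofReal_mul, Complex.ofReal_re]; field_simp
  have key' : ‖x‖ * ‖y‖ ≤ c / 2 * (‖x‖ ^ 2 + ‖x‖ ^ 2) := by rw [← e]; exact key
  have : ‖x‖ * ‖y‖ ≤ ‖x‖ * (c * ‖x‖) := by nlinarith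
  exact le_of_mul_le_mul_left this hx0

lemma dotProduct_mulVec_eq_sum (A : Matrix (Fin n) (Fin n) ℂ) (u v : Fin n → ℂ) :
    star v ⬝ᵥ (A *ᵥ u) = ∑ i, ∑ j, star (v i) * A i j * u j := by
  simp [dotProduct, mulVec, Finset.mul_sum, mul_assoc]

/-- The bound on a Schur product given by a Gram representation of the multiplier. -/
lemma opNorm_hadamard_le {κ : Type*} [Fintype κ] {Y : Matrix (Fin n) (Fin n) ℂ}
    {L R : κ → Fin n → ℂ} {c : ℝ} (hc : 0 ≤ c) (hY : ∀ i j, Y i j = ∑ k, star (L k i) * R k j)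
    (hL : ∀ j, ∑ k, ‖L k j‖ ^ 2 ≤ c) (hR : ∀ j, ∑ k, ‖R k j‖ ^ 2 ≤ c)
    {A : Matrix (Fin n) (Fin n) ℂ} (hA : opNorm A ≤ 1) : opNorm (Y ⊙ A) ≤ c := by
  refine opNorm_le_of_re_le _ hc fun u v => ?_
  have e : star v ⬝ᵥ ((Y ⊙ A) *ᵥ u) =
      ∑ k, star (fun i => L k i * v i) ⬝ᵥ (A *ᵥ (fun j => R k j * u j)) := by
    simp only [dotProduct_mulVec_eq_sum, hadamard_apply, hY, star_mul']
    rw [Finset.sum_comm]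
    simp only [Finset.mul_sum, Finset.sum_mul]
    rw [Finset.sum_comm]
    conv_rhs => rw [Finset.sum_comm]
    refine Finset.sum_congr rfl fun i _ => ?_
    conv_rhs => rw [Finset.sum_comm]
    exact Finset.sum_congr rfl fun j _ => Finset.sum_congr rfl fun k _ => by ring
  rw [e, Complex.re_sum]
  have bound : ∀ (W : κ → Fin n → ℂ) (w : Fin n → ℂ), (∀ j, ∑ k, ‖W k j‖ ^ 2 ≤ c) →
      ∑ k, ∑ j, ‖W k j * w j‖ ^ 2 ≤ c * ∑ j, ‖w j‖ ^ 2 := by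
    intro W w hW
    rw [Finset.sum_comm, Finset.mul_sum]
    refine Finset.sum_le_sum fun j _ => ?_
    simp only [norm_mul, mul_pow, ← Finset.sum_mul]
    gcongr
    exact hW j
  calc _ ≤ ∑ k, (1 / 2 : ℝ) * (∑ j, ‖R k j * u j‖ ^ 2 + ∑ j, ‖L k j * v j‖ ^ 2) := by
        refine Finset.sum_le_sum fun k _ => (re_dotProduct_mulVec_le A _ _).trans ?_
        gcongr
    _ = 1 / 2 * (∑ k, ∑ j, ‖R k j * u j‖ ^ 2 + ∑ k, ∑ j, ‖L k j * v j‖ ^ 2) := by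
        rw [← Finset.mul_sum, Finset.sum_add_distrib]
    _ ≤ 1 / 2 * (c * ∑ j, ‖u j‖ ^ 2 + c * ∑ j, ‖v j‖ ^ 2) := by
        gcongr
        · exact bound R u hR
        · exact bound L v hL
    _ = _ := by ring

lemma opNorm_zero : opNorm (0 : Matrix (Fin n) (Fin n) ℂ) = 0 := by simp [opNorm]

lemma opNorm_smul (c : ℂ) (A : Matrix (Fin n) (Fin n) ℂ) : opNorm (c • A) = ‖c‖ * opNorm A := by
  simp [opNorm, norm_smul]

lemma opNorm_eq_zero {A : Matrix (Fin n) (Fin n) ℂ} : opNorm A = 0 ↔ A = 0 := by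
  simp [opNorm]

lemma schurNorm_le {κ : Type*} [Fintype κ] {Y : Matrix (Fin n) (Fin n) ℂ}
    {L R : κ → Fin n → ℂ} {c : ℝ} (hc : 0 ≤ c) (hY : ∀ i j, Y i j = ∑ k, star (L k i) * R k j)
    (hL : ∀ j, ∑ k, ‖L k j‖ ^ 2 ≤ c) (hR : ∀ j, ∑ k, ‖R k j‖ ^ 2 ≤ c) : schurNorm Y ≤ c := by
  refine csSup_le ⟨_, 0, by rw [opNorm_zero]; exact zero_le_one, rfl⟩ ?_
  rintro r ⟨A, hA, rfl⟩
  exact opNorm_hadamard_le hc hY hL hR hA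

lemma schurNorm_bddAbove (Y : Matrix (Fin n) (Fin n) ℂ) :
    BddAbove {r : ℝ | ∃ A : Matrix (Fin n) (Fin n) ℂ, opNorm A ≤ 1 ∧ r = opNorm (Y ⊙ A)} := by
  refine ⟨1 + ∑ j, ∑ k, ‖Y k j‖ ^ 2, ?_⟩
  rintro r ⟨A, hA, rfl⟩
  -- The trivial Gram representation `Y = 1 * Y` suffices for a crude finite bound.
  refine opNorm_hadamard_le (κ := Fin n) (L := fun k i => if k = i then 1 else 0)
    (R := fun k j => Y k j) (by positivity) (by simp) (fun j => ?_) (fun j => ?_) hA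
  · simp only [apply_ite norm, ite_pow]
    simp
    positivity
  · have : ∑ k, ‖Y k j‖ ^ 2 ≤ ∑ j, ∑ k, ‖Y k j‖ ^ 2 :=
      Finset.single_le_sum (f := fun j => ∑ k, ‖Y k j‖ ^ 2)
        (fun j _ => by positivity) (Finset.mem_univ j)
    linarith

lemma opNorm_hadamard_le_schurNorm (Y A : Matrix (Fin n) (Fin n) ℂ) :
    opNorm (Y ⊙ A) ≤ schurNorm Y * opNorm A := by
  rcases eq_or_ne A 0 with rfl | hA
  · rw [hadamard_zero, opNorm_zero, mul_zero]
  have h0 : 0 < opNorm A := lt_of_le_of_ne (opNorm_nonneg A) (fun h => hA (opNorm_eq_zero.1 h.symm))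
  have : opNorm (Y ⊙ ((((opNorm A)⁻¹ : ℝ) : ℂ) • A)) ≤ schurNorm Y := by
    refine le_csSup (schurNorm_bddAbove Y) ⟨_, ?_, rfl⟩
    rw [opNorm_smul, Complex.norm_real, Real.norm_of_nonneg (by positivity),
      inv_mul_cancel₀ h0.ne']
  rw [hadamard_smul, opNorm_smul, Complex.norm_real, Real.norm_of_nonneg (by positivity)] at this
  rwa [inv_mul_le_iff₀ h0, mul_comm] at this

lemma schurNorm_nonneg (Y : Matrix (Fin n) (Fin n) ℂ) : 0 ≤ schurNorm Y := by
  refine le_csSup (schurNorm_bddAbove Y) ⟨0, ?_, ?_⟩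
  · rw [opNorm_zero]; exact zero_le_one
  · rw [hadamard_zero, opNorm_zero]

lemma schurNorm_smul_le (c : ℝ) (hc : 0 ≤ c) (Y : Matrix (Fin n) (Fin n) ℂ) :
    schurNorm ((c : ℂ) • Y) ≤ c * schurNorm Y := by
  refine csSup_le ⟨_, 0, by rw [opNorm_zero]; exact zero_le_one, rfl⟩ ?_
  rintro r ⟨A, hA, rfl⟩
  rw [smul_hadamard, opNorm_smul, Complex.norm_real, Real.norm_of_nonneg hc]
  gcongr
  exact le_csSup (schurNorm_bddAbove Y) ⟨A, hA, rfl⟩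

lemma norm_apply_le_opNorm (A : Matrix (Fin n) (Fin n) ℂ) (i j : Fin n) : ‖A i j‖ ≤ opNorm A := by
  have := norm_dotProduct_mulVec_le A (Pi.single j 1) (Pi.single i 1)
  simpa [← Pi.single_star] using this

lemma norm_diag_le_schurNorm (Y : Matrix (Fin n) (Fin n) ℂ) (j : Fin n) :
    ‖Y j j‖ ≤ schurNorm Y := by
  have h1 : opNorm (1 : Matrix (Fin n) (Fin n) ℂ) ≤ 1 := by
    rw [opNorm, map_one]
    exact ContinuousLinearMap.norm_id_le
  calc ‖Y j j‖ = ‖(Y ⊙ 1) j j‖ := by simp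
    _ ≤ opNorm (Y ⊙ 1) := norm_apply_le_opNorm _ _ _
    _ ≤ schurNorm Y := le_csSup (schurNorm_bddAbove Y) ⟨1, h1, rfl⟩

/-- The form of the conjugated matrix at `u, v` is the conjugate of the form of `T` at `star u, star
v`. It is needed because the trace pairing conjugates one factor. -/
lemma opNorm_map_star_le (T : Matrix (Fin n) (Fin n) ℂ) : opNorm (T.map star) ≤ opNorm T := by
  refine opNorm_le_of_re_le _ (opNorm_nonneg T) fun u v => ?_
  have := re_dotProduct_mulVec_le T (star u) (star v)
  simp only [Pi.star_apply, norm_star] at this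
  refine le_trans (le_of_eq ?_) this
  rw [← Complex.conj_re]
  congr 1
  rw [dotProduct_mulVec_eq_sum, dotProduct_mulVec_eq_sum]
  simp

/-! ### The dual norm and diagonal factorizations -/

lemma trace_conjTranspose_mul (Y X : Matrix (Fin n) (Fin n) ℂ) :
    (Yᴴ * X).trace = ∑ i, ∑ j, star (Y i j) * X i j := by
  simp only [Matrix.trace, diag_apply, mul_apply, conjTranspose_apply]
  exact Finset.sum_comm

lemma norm_toLp_ofReal (a : Fin n → ℝ) :
    ‖WithLp.toLp 2 (fun i => (a i : ℂ))‖ = √(∑ i, a i ^ 2) := by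
  rw [EuclideanSpace.norm_eq]; simp

/-- Up to conjugation the trace is the sesquilinear form of the Schur product of `Y` with the
entrywise conjugate of `T`, evaluated at `a` and `b`. -/
lemma norm_trace_le (Y T : Matrix (Fin n) (Fin n) ℂ) (a b : Fin n → ℝ) :
    ‖(Yᴴ * (diagMat a * T * diagMat b)).trace‖ ≤
      schurNorm Y * (opNorm T * (√(∑ i, a i ^ 2) * √(∑ i, b i ^ 2))) := by
  have e : star (Yᴴ * (diagMat a * T * diagMat b)).trace =
      star (fun i => (a i : ℂ)) ⬝ᵥ ((Y ⊙ T.map star) *ᵥ (fun i => (b i : ℂ))) := by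
    rw [trace_conjTranspose_mul, dotProduct_mulVec_eq_sum]
    simp only [star_sum, diagMat, mul_diagonal, diagonal_mul, hadamard_apply, map_apply, star_mul']
    refine Finset.sum_congr rfl fun i _ => Finset.sum_congr rfl fun j _ => ?_
    simp
    ring
  rw [← norm_star, e]
  refine (norm_dotProduct_mulVec_le _ _ _).trans ?_
  rw [norm_toLp_ofReal, norm_toLp_ofReal]
  have h1 := (opNorm_hadamard_le_schurNorm Y (T.map star)).trans
    (mul_le_mul_of_nonneg_left (opNorm_map_star_le T) (schurNorm_nonneg Y))
  calc _ ≤ (schurNorm Y * opNorm T) * (√(∑ i, b i ^ 2) * √(∑ i, a i ^ 2)) := by gcongr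
    _ = _ := by ring

lemma cbBNorm_le (T : Matrix (Fin n) (Fin n) ℂ) (a b : Fin n → ℝ) :
    cbBNorm (diagMat a * T * diagMat b) ≤ opNorm T * (√(∑ i, a i ^ 2) * √(∑ i, b i ^ 2)) := by
  refine csSup_le ⟨_, 0, ?_, rfl⟩ ?_
  · exact schurNorm_le (κ := Fin 0) (L := 0) (R := 0) zero_le_one (by simp) (by simp) (by simp)
  · rintro r ⟨Y, hY, rfl⟩
    refine (norm_trace_le Y T a b).trans (mul_le_of_le_one_left ?_ hY)
    exact mul_nonneg (opNorm_nonneg T) (by positivity)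

lemma norm_trace_le_cbBNorm (X : Matrix (Fin n) (Fin n) ℂ) {Y : Matrix (Fin n) (Fin n) ℂ}
    (hY : schurNorm Y ≤ 1) : ‖(Yᴴ * X).trace‖ ≤ cbBNorm X := by
  -- The supremum is finite by the factorization `X = 1 * X * 1`.
  refine le_csSup ⟨opNorm X * (√(∑ i : Fin n, (1 : ℝ) ^ 2) * √(∑ i : Fin n, (1 : ℝ) ^ 2)), ?_⟩
    ⟨Y, hY, rfl⟩
  rintro r ⟨Y, hY, rfl⟩
  have := norm_trace_le Y X (fun _ => 1) (fun _ => 1)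
  have e : diagMat (fun _ : Fin n => (1 : ℝ)) = 1 := by simp [diagMat]
  rw [e, one_mul, mul_one] at this
  refine this.trans (mul_le_of_le_one_left ?_ hY)
  exact mul_nonneg (opNorm_nonneg X) (by positivity)

lemma cbBNorm_nonneg (X : Matrix (Fin n) (Fin n) ℂ) : 0 ≤ cbBNorm X := by
  refine (norm_nonneg _).trans (norm_trace_le_cbBNorm X (Y := 0) ?_)
  exact schurNorm_le (κ := Fin 0) (L := 0) (R := 0) zero_le_one (by simp) (by simp) (by simp)

lemma norm_trace_le_mul_cbBNorm (X : Matrix (Fin n) (Fin n) ℂ) {Y : Matrix (Fin n) (Fin n) ℂ}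
    {c : ℝ} (hc : 0 < c) (hY : schurNorm Y ≤ c) : ‖(Yᴴ * X).trace‖ ≤ c * cbBNorm X := by
  have h := norm_trace_le_cbBNorm X (Y := ((c⁻¹ : ℝ) : ℂ) • Y) (by
    refine (schurNorm_smul_le _ (by positivity) Y).trans ?_
    rwa [inv_mul_le_iff₀ hc, mul_one])
  rw [conjTranspose_smul, smul_mul, trace_smul, norm_smul, norm_star, Complex.norm_real,
    Real.norm_of_nonneg (by positivity)] at h
  rwa [inv_mul_le_iff₀ hc] at h

/-! ### From primal feasibility to a factorization -/

lemma exists_eq_smul_coord {v : Fin n → ℂ} (hv : v ≠ 0) :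
    ∃ (r : ℝ) (ξ : UnitVec n), v = (r : ℂ) • ξ.coord := by
  have h0 : WithLp.toLp 2 v ≠ 0 := by simpa using hv
  have hr : ‖WithLp.toLp 2 v‖ ≠ 0 := norm_ne_zero_iff.2 h0
  refine ⟨‖WithLp.toLp 2 v‖, ⟨((‖WithLp.toLp 2 v‖⁻¹ : ℝ) : ℂ) • WithLp.toLp 2 v, ?_⟩, ?_⟩
  · rw [mem_sphere_zero_iff_norm, norm_smul, Complex.norm_real, norm_inv, norm_norm,
      inv_mul_cancel₀ hr]
  · have : ((‖WithLp.toLp 2 v‖ : ℝ) : ℂ) ≠ 0 := Complex.ofReal_ne_zero.2 hr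
    ext j
    simp [UnitVec.coord, mul_inv_cancel_left₀ this]

lemma re_smul_quadratic (X : Matrix (Fin n) (Fin n) ℂ) (r : ℝ) (v : Fin n → ℂ) :
    (star ((r : ℂ) • v) ⬝ᵥ (X *ᵥ ((r : ℂ) • v))).re = r ^ 2 * (star v ⬝ᵥ (X *ᵥ v)).re := by
  rw [mulVec_smul, star_smul, smul_dotProduct, dotProduct_smul, smul_eq_mul, smul_eq_mul,
    ← mul_assoc]
  have : star (r : ℂ) * (r : ℂ) = ((r ^ 2 : ℝ) : ℂ) := by
    simp [sq]
  rw [this, Complex.re_ofReal_mul]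

lemma PrimalFeasible.abs_re_le {X : Matrix (Fin n) (Fin n) ℂ} {l : Fin n → ℝ}
    (h : PrimalFeasible X l) (v : Fin n → ℂ) :
    |(star v ⬝ᵥ (X *ᵥ v)).re| ≤ ∑ j, l j * ‖v j‖ ^ 2 := by
  rcases eq_or_ne v 0 with rfl | hv
  · simp
  obtain ⟨r, ξ, rfl⟩ := exists_eq_smul_coord hv
  have e : ∑ j, l j * ‖((r : ℂ) • ξ.coord) j‖ ^ 2 = r ^ 2 * ∑ j, l j * ‖ξ.coord j‖ ^ 2 := by
    rw [Finset.mul_sum]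
    refine Finset.sum_congr rfl fun j _ => ?_
    rw [Pi.smul_apply, norm_smul, Complex.norm_real, mul_pow, Real.norm_eq_abs, sq_abs]
    ring
  rw [re_smul_quadratic, e, abs_mul, abs_of_nonneg (sq_nonneg r)]
  gcongr
  exact abs_le'.2 ⟨h.upper ξ, h.lower ξ⟩

lemma re_dotProduct_mulVec_comm {X : Matrix (Fin n) (Fin n) ℂ} (hX : X.IsHermitian)
    (u v : Fin n → ℂ) : (star u ⬝ᵥ (X *ᵥ v)).re = (star v ⬝ᵥ (X *ᵥ u)).re := by
  have : star (star u ⬝ᵥ (X *ᵥ v)) = star v ⬝ᵥ (X *ᵥ u) := by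
    rw [star_dotProduct, star_star, star_mulVec, hX.eq, dotProduct_mulVec]
  rw [← this]
  exact (Complex.conj_re _).symm

lemma norm_add_sq_add_norm_sub_sq (a b : ℂ) :
    ‖a + b‖ ^ 2 + ‖a - b‖ ^ 2 = 2 * (‖a‖ ^ 2 + ‖b‖ ^ 2) := by
  have := parallelogram_law_with_norm ℝ a b
  simp only [sq]; linarith

/-- Polarization: the constraints at `u + v` and `u - v` are combined by the parallelogram law. -/
lemma PrimalFeasible.re_le {X : Matrix (Fin n) (Fin n) ℂ} {l : Fin n → ℝ}
    (hX : X.IsHermitian) (h : PrimalFeasible X l) (u v : Fin n → ℂ) :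
    (star v ⬝ᵥ (X *ᵥ u)).re ≤ 1 / 2 * (∑ j, l j * ‖u j‖ ^ 2 + ∑ j, l j * ‖v j‖ ^ 2) := by
  have h1 := (abs_le.1 (h.abs_re_le (u + v))).2
  have h2 := (abs_le.1 (h.abs_re_le (u - v))).1
  have e1 : (star (u + v) ⬝ᵥ (X *ᵥ (u + v))).re = (star u ⬝ᵥ (X *ᵥ u)).re
      + (star v ⬝ᵥ (X *ᵥ v)).re + 2 * (star v ⬝ᵥ (X *ᵥ u)).re := by
    simp only [star_add, mulVec_add, add_dotProduct, dotProduct_add, Complex.add_re]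
    rw [re_dotProduct_mulVec_comm hX u v]; ring
  have e2 : (star (u - v) ⬝ᵥ (X *ᵥ (u - v))).re = (star u ⬝ᵥ (X *ᵥ u)).re
      + (star v ⬝ᵥ (X *ᵥ v)).re - 2 * (star v ⬝ᵥ (X *ᵥ u)).re := by
    simp only [star_sub, mulVec_sub, sub_dotProduct, dotProduct_sub, Complex.sub_re]
    rw [re_dotProduct_mulVec_comm hX u v]; ring
  have e3 : ∑ j, l j * ‖(u + v) j‖ ^ 2 + ∑ j, l j * ‖(u - v) j‖ ^ 2 =
      2 * (∑ j, l j * ‖u j‖ ^ 2 + ∑ j, l j * ‖v j‖ ^ 2) := by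
    rw [← Finset.sum_add_distrib, ← Finset.sum_add_distrib, Finset.mul_sum]
    refine Finset.sum_congr rfl fun j _ => ?_
    rw [Pi.add_apply, Pi.sub_apply, ← mul_add, norm_add_sq_add_norm_sub_sq]; ring
  rw [e1] at h1
  rw [e2] at h2
  linarith

/-- A coordinate of zero weight can be scaled at no cost on the right of `PrimalFeasible.re_le`. The
factor `t` makes the left side `l j + 1`, while the right side stays `l j / 2`. -/
lemma PrimalFeasible.apply_eq_zero {X : Matrix (Fin n) (Fin n) ℂ} {l : Fin n → ℝ}
    (hX : X.IsHermitian) (h : PrimalFeasible X l) {i : Fin n} (hi : l i = 0) (j : Fin n) :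
    X i j = 0 := by
  by_contra hne
  have hpos : 0 < ‖X i j‖ ^ 2 := by positivity
  set t : ℝ := (l j + 1) / ‖X i j‖ ^ 2 with ht
  have key := h.re_le hX (Pi.single j 1) (Pi.single i ((t : ℂ) * X i j))
  have e1 : ∑ k, l k * ‖(Pi.single j 1 : Fin n → ℂ) k‖ ^ 2 = l j := by
    rw [Finset.sum_eq_single j (fun k _ hk => by simp [hk]) (by simp)]; simp
  have e2 : ∑ k, l k * ‖(Pi.single i ((t : ℂ) * X i j) : Fin n → ℂ) k‖ ^ 2 = 0 := by
    rw [Finset.sum_eq_single i (fun k _ hk => by simp [hk]) (by simp)]; simp [hi]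
  have e3 : (star (Pi.single i ((t : ℂ) * X i j)) ⬝ᵥ (X *ᵥ (Pi.single j 1))).re =
      t * ‖X i j‖ ^ 2 := by
    rw [← Pi.single_star, single_dotProduct, mulVec_single_one, col_apply, star_mul', mul_assoc]
    have : star (X i j) * X i j = ((‖X i j‖ ^ 2 : ℝ) : ℂ) := by
      rw [Complex.star_def, Complex.conj_mul', Complex.ofReal_pow]
    rw [this, Complex.star_def, Complex.conj_ofReal, ← Complex.ofReal_mul, Complex.ofReal_re]
  rw [e1, e2, e3, ht, div_mul_cancel₀ _ hpos.ne'] at key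
  have := h.nonneg j
  linarith

/-- The matrix `Δ(l)^{-1/2} X Δ(l)^{-1/2}`, with zero rows and columns where `l` vanishes. -/
noncomputable def normalized (X : Matrix (Fin n) (Fin n) ℂ) (l : Fin n → ℝ) :
    Matrix (Fin n) (Fin n) ℂ :=
  diagMat (fun i => (√(l i))⁻¹) * X * diagMat (fun i => (√(l i))⁻¹)

lemma diagMat_mul_mul_diagMat_apply (a b : Fin n → ℝ) (T : Matrix (Fin n) (Fin n) ℂ)
    (i j : Fin n) : (diagMat a * T * diagMat b) i j = a i * T i j * b j := by
  simp [diagMat, mul_diagonal, diagonal_mul]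

lemma isHermitian_diagMat (a : Fin n → ℝ) : (diagMat a).IsHermitian := by
  ext i j
  simp only [diagMat, conjTranspose_apply, diagonal_apply]
  by_cases h : i = j
  · subst h; simp
  · simp [h, Ne.symm h]

lemma normalized_isHermitian {X : Matrix (Fin n) (Fin n) ℂ} (hX : X.IsHermitian)
    (l : Fin n → ℝ) : (normalized X l).IsHermitian := by
  rw [normalized, IsHermitian, conjTranspose_mul, conjTranspose_mul, hX.eq,
    (isHermitian_diagMat _).eq, mul_assoc]

lemma PrimalFeasible.factor {X : Matrix (Fin n) (Fin n) ℂ} {l : Fin n → ℝ}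
    (hX : X.IsHermitian) (h : PrimalFeasible X l) :
    X = diagMat (fun i => √(l i)) * normalized X l * diagMat (fun i => √(l i)) := by
  ext i j
  rw [diagMat_mul_mul_diagMat_apply, normalized, diagMat_mul_mul_diagMat_apply]
  -- Here `0⁻¹ = 0` kills the right side, and a zero weight also forces a zero row or column of `X`.
  by_cases hi : l i = 0
  · simp [h.apply_eq_zero hX hi j]
  by_cases hj : l j = 0
  · have : X i j = 0 := by
      rw [← hX.apply, h.apply_eq_zero hX hj i, star_zero]
    simp [this]
  have h1 : (√(l i) : ℂ) ≠ 0 := Complex.ofReal_ne_zero.2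
    (Real.sqrt_pos.2 (lt_of_le_of_ne (h.nonneg i) (Ne.symm hi))).ne'
  have h2 : (√(l j) : ℂ) ≠ 0 := Complex.ofReal_ne_zero.2
    (Real.sqrt_pos.2 (lt_of_le_of_ne (h.nonneg j) (Ne.symm hj))).ne'
  push_cast
  field_simp

lemma dotProduct_diagMat_mul_mul_diagMat (a b : Fin n → ℝ) (T : Matrix (Fin n) (Fin n) ℂ)
    (u v : Fin n → ℂ) : star v ⬝ᵥ ((diagMat a * T * diagMat b) *ᵥ u) =
      star (fun i => (a i : ℂ) * v i) ⬝ᵥ (T *ᵥ (fun j => (b j : ℂ) * u j)) := by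
  simp only [dotProduct_mulVec_eq_sum, diagMat_mul_mul_diagMat_apply]
  refine Finset.sum_congr rfl fun i _ => Finset.sum_congr rfl fun j _ => ?_
  simp only [star_mul', Complex.star_def, Complex.conj_ofReal]
  ring

lemma PrimalFeasible.opNorm_normalized_le {X : Matrix (Fin n) (Fin n) ℂ} {l : Fin n → ℝ}
    (hX : X.IsHermitian) (h : PrimalFeasible X l) : opNorm (normalized X l) ≤ 1 := by
  refine opNorm_le_of_re_le _ zero_le_one fun u v => ?_
  rw [normalized, dotProduct_diagMat_mul_mul_diagMat]
  refine (h.re_le hX _ _).trans ?_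
  have bound : ∀ w : Fin n → ℂ,
      ∑ j, l j * ‖(((√(l j))⁻¹ : ℝ) : ℂ) * w j‖ ^ 2 ≤ ∑ j, ‖w j‖ ^ 2 := by
    intro w
    refine Finset.sum_le_sum fun j _ => ?_
    rw [norm_mul, Complex.norm_real, mul_pow, Real.norm_eq_abs, sq_abs, inv_pow,
      Real.sq_sqrt (h.nonneg j), ← mul_assoc]
    exact mul_le_of_le_one_left (by positivity) mul_inv_le_one
  have := bound u
  have := bound v
  linarith

lemma PrimalFeasible.cbBNorm_le_sum {X : Matrix (Fin n) (Fin n) ℂ} {l : Fin n → ℝ}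
    (hX : X.IsHermitian) (h : PrimalFeasible X l) : cbBNorm X ≤ ∑ j, l j := by
  have h1 := cbBNorm_le (normalized X l) (fun i => √(l i)) (fun i => √(l i))
  rw [← h.factor hX] at h1
  have h2 : ∑ i, √(l i) ^ 2 = ∑ i, l i :=
    Finset.sum_congr rfl fun i _ => Real.sq_sqrt (h.nonneg i)
  have h0 : 0 ≤ ∑ i, l i := Finset.sum_nonneg fun i _ => h.nonneg i
  rw [h2, Real.mul_self_sqrt h0] at h1
  exact h1.trans (mul_le_of_le_one_left h0 (h.opNorm_normalized_le hX))

lemma cbBNorm_zero : cbBNorm (0 : Matrix (Fin n) (Fin n) ℂ) = 0 := by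
  refine le_antisymm ?_ (cbBNorm_nonneg _)
  have := cbBNorm_le (0 : Matrix (Fin n) (Fin n) ℂ) (fun _ => 0) (fun _ => 0)
  simpa [opNorm_zero] using this

/-! ### The cbB-factorization and its uniqueness -/

lemma IsCbBFactorization.apply {X B : Matrix (Fin n) (Fin n) ℂ} {η ξ : Fin n → ℝ}
    (h : IsCbBFactorization X η B ξ) (i j : Fin n) : X i j = η i * B i j * ξ j := by
  conv_lhs => rw [h.factor]
  exact diagMat_mul_mul_diagMat_apply _ _ _ _ _

lemma isCbBFactorization_of_primal {X : Matrix (Fin n) (Fin n) ℂ} {l : Fin n → ℝ}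
    (hX : X.IsHermitian) (h : PrimalFeasible X l) (hl : ∑ j, l j = cbBNorm X)
    (hK : 0 < cbBNorm X) :
    IsCbBFactorization X (fun j => √(l j / cbBNorm X)) ((cbBNorm X : ℂ) • normalized X l)
      (fun j => √(l j / cbBNorm X)) := by
  have hunit : ∑ j, √(l j / cbBNorm X) ^ 2 = 1 := by
    rw [Finset.sum_congr rfl fun j _ => Real.sq_sqrt (div_nonneg (h.nonneg j) hK.le),
      ← Finset.sum_div, hl, div_self hK.ne']
  have hz : ∀ i, √(l i / cbBNorm X) = 0 → √(l i) = 0 := by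
    intro i hi
    rw [Real.sqrt_div (h.nonneg i), div_eq_zero_iff] at hi
    exact hi.resolve_right (Real.sqrt_pos.2 hK).ne'
  have hfac : X = diagMat (fun j => √(l j / cbBNorm X)) * ((cbBNorm X : ℂ) • normalized X l) *
      diagMat (fun j => √(l j / cbBNorm X)) := by
    ext i j
    have e := congrFun (congrFun (h.factor hX) i) j
    rw [diagMat_mul_mul_diagMat_apply] at e ⊢
    rw [Real.sqrt_div (h.nonneg i), Real.sqrt_div (h.nonneg j), Matrix.smul_apply, smul_eq_mul, e]
    have hs : ((√(cbBNorm X) : ℝ) : ℂ) * ((√(cbBNorm X) : ℝ) : ℂ) = (cbBNorm X : ℂ) := by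
      rw [← Complex.ofReal_mul, Real.mul_self_sqrt hK.le]
    have hs0 : ((√(cbBNorm X) : ℝ) : ℂ) ≠ 0 := Complex.ofReal_ne_zero.2 (Real.sqrt_pos.2 hK).ne'
    rw [← hs]
    push_cast
    field_simp
  refine ⟨fun i => Real.sqrt_nonneg _, fun i => Real.sqrt_nonneg _, hunit, hunit, hfac, ?_, ?_, ?_⟩
  · refine le_antisymm ?_ ?_
    · rw [opNorm_smul, Complex.norm_real, Real.norm_of_nonneg hK.le]
      exact mul_le_of_le_one_right hK.le (h.opNorm_normalized_le hX)
    -- With unit outer vectors, the middle matrix of any factorization of `X` has norm at least the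
    -- cbB-norm.
    · have := cbBNorm_le ((cbBNorm X : ℂ) • normalized X l) (fun j => √(l j / cbBNorm X))
        (fun j => √(l j / cbBNorm X))
      rw [← hfac, hunit] at this
      simpa using this
  · intro i j hi
    simp [normalized, diagMat_mul_mul_diagMat_apply, hz i hi]
  · intro i j hj
    simp [normalized, diagMat_mul_mul_diagMat_apply, hz j hj]

/-- The norm of the self-adjoint `a * b` is its spectral radius, and `a * b` and `b * a` have the
same nonzero spectrum. -/
lemma norm_mul_le_of_isSelfAdjoint {A : Type*} [CStarAlgebra A] [Nontrivial A] {a b : A}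
    (h : IsSelfAdjoint (a * b)) : ‖a * b‖ ≤ ‖b * a‖ := by
  have h1 : spectralRadius ℂ (a * b) ≤ spectralRadius ℂ (b * a) := by
    refine iSup₂_le fun k hk => ?_
    rcases eq_or_ne k 0 with rfl | hk0
    · simp
    have : k ∈ spectrum ℂ (b * a) :=
      ((spectrum.nonzero_mul_comm (𝕜 := ℂ) a b).subset ⟨hk, hk0⟩).1
    exact le_iSup₂ (f := fun (k : ℂ) (_ : k ∈ spectrum ℂ (b * a)) => (‖k‖₊ : ENNReal)) k this
  rw [h.spectralRadius_eq_nnnorm] at h1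
  exact_mod_cast h1.trans (spectrum.spectralRadius_le_nnnorm (b * a))

lemma opNorm_mul_le_of_isHermitian [NeZero n] {P Q : Matrix (Fin n) (Fin n) ℂ}
    (h : (P * Q).IsHermitian) : opNorm (P * Q) ≤ opNorm (Q * P) := by
  unfold opNorm
  rw [map_mul, map_mul]
  apply norm_mul_le_of_isSelfAdjoint
  rw [← map_mul]
  have : IsSelfAdjoint (P * Q) := h
  exact this.map _

lemma opNorm_mul_le (P Q : Matrix (Fin n) (Fin n) ℂ) : opNorm (P * Q) ≤ opNorm P * opNorm Q := by
  unfold opNorm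
  rw [map_mul]
  exact norm_mul_le _ _

lemma opNorm_conjTranspose (P : Matrix (Fin n) (Fin n) ℂ) : opNorm Pᴴ = opNorm P := by
  unfold opNorm
  rw [← star_eq_conjTranspose, map_star]
  exact norm_star (Matrix.toEuclideanCLM (n := Fin n) (𝕜 := ℂ) P)

lemma opNorm_mul_conjTranspose (P : Matrix (Fin n) (Fin n) ℂ) :
    opNorm (P * Pᴴ) = opNorm P * opNorm P := by
  unfold opNorm
  rw [← star_eq_conjTranspose, map_mul, map_star]
  exact CStarRing.norm_self_mul_star

lemma diagMat_mul_diagMat (a b : Fin n → ℝ) :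
    diagMat a * diagMat b = diagMat (fun i => a i * b i) := by
  simp [diagMat]

/-- The Heinz inequality for a pair of nonnegative diagonal matrices, at the exponent `1 / 2`. -/
lemma opNorm_sqrt_sq_le [NeZero n] (B : Matrix (Fin n) (Fin n) ℂ) {d c : Fin n → ℝ}
    (hd : ∀ i, 0 ≤ d i) (hc : ∀ i, 0 ≤ c i) :
    opNorm (diagMat (fun i => √(d i)) * B * diagMat (fun i => √(c i))) ^ 2 ≤
      opNorm B * opNorm (diagMat d * B * diagMat c) := by
  set D := diagMat (fun i => √(d i)) with hD
  set C := diagMat (fun i => √(c i)) with hC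
  have hDD : D * D = diagMat d := by
    rw [hD, diagMat_mul_diagMat]; congr 1; ext i; exact Real.mul_self_sqrt (hd i)
  have hCC : C * C = diagMat c := by
    rw [hC, diagMat_mul_diagMat]; congr 1; ext i; exact Real.mul_self_sqrt (hc i)
  have hDs : Dᴴ = D := isHermitian_diagMat _
  have hCs : Cᴴ = C := isHermitian_diagMat _
  -- The product is self-adjoint, so moving the first `D` to the end cannot decrease the norm; it
  -- completes `D * D` there.
  have e : (D * B * C) * (D * B * C)ᴴ = D * (B * (C * C) * Bᴴ * D) := by
    simp only [conjTranspose_mul, hDs, hCs, mul_assoc]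
  have e' : (B * (C * C) * Bᴴ * D) * D = B * (diagMat d * B * diagMat c)ᴴ := by
    simp only [conjTranspose_mul, hCC, (isHermitian_diagMat _).eq, mul_assoc, hDD]
  rw [sq, ← opNorm_mul_conjTranspose, e]
  refine (opNorm_mul_le_of_isHermitian ?_).trans ?_
  · rw [← e]; exact isHermitian_mul_conjTranspose_self _
  · rw [e']
    refine (opNorm_mul_le _ _).trans ?_
    rw [opNorm_conjTranspose]

lemma IsCbBFactorization.cbBNorm_pos {X B : Matrix (Fin n) (Fin n) ℂ} {η ξ : Fin n → ℝ}
    (h : IsCbBFactorization X η B ξ) (hX : X ≠ 0) : 0 < cbBNorm X := by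
  rw [← h.norm_eq]
  refine lt_of_le_of_ne (opNorm_nonneg B) fun h0 => hX ?_
  rw [h.factor, opNorm_eq_zero.1 h0.symm, mul_zero, zero_mul]

lemma IsCbBFactorization.conjTranspose {X B : Matrix (Fin n) (Fin n) ℂ} {η ξ : Fin n → ℝ}
    (hX : X.IsHermitian) (h : IsCbBFactorization X η B ξ) : IsCbBFactorization X ξ Bᴴ η where
  nonneg_left := h.nonneg_right
  nonneg_right := h.nonneg_left
  unit_left := h.unit_right
  unit_right := h.unit_left
  factor := by
    conv_lhs => rw [← hX.eq, h.factor]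
    simp only [conjTranspose_mul, (isHermitian_diagMat _).eq, mul_assoc]
  norm_eq := by rw [opNorm_conjTranspose, h.norm_eq]
  range_le i j hi := by rw [conjTranspose_apply, h.support_le j i hi, star_zero]
  support_le i j hj := by rw [conjTranspose_apply, h.range_le j i hj, star_zero]

/-- In a cbB-factorization of a nonzero matrix, the left vector vanishes exactly where the rows of
the matrix vanish. -/
lemma IsCbBFactorization.left_eq_zero_iff {X B : Matrix (Fin n) (Fin n) ℂ} {η ξ : Fin n → ℝ}
    (h : IsCbBFactorization X η B ξ) (hX : X ≠ 0) (i : Fin n) :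
    η i = 0 ↔ ∀ j, X i j = 0 := by
  refine ⟨fun hi j => by rw [h.apply, hi]; simp, fun hi => ?_⟩
  have hK := h.cbBNorm_pos hX
  -- If row `i` of `X` vanishes, erasing `η i` keeps the factorization; by `cbBNorm_le` the
  -- shortened vector must still have norm at least one.
  set η' : Fin n → ℝ := Function.update η i 0 with hη'
  have hfac : X = diagMat η' * B * diagMat ξ := by
    ext k j
    rw [diagMat_mul_mul_diagMat_apply, hη']
    rcases eq_or_ne k i with rfl | hk
    · simp [hi j]
    · rw [Function.update_of_ne hk, h.apply]
  have h1 := cbBNorm_le B η' ξ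
  rw [← hfac, h.norm_eq, h.unit_right, Real.sqrt_one, mul_one] at h1
  have h2 : 1 ≤ √(∑ k, η' k ^ 2) := le_of_mul_le_mul_left (by rwa [mul_one]) hK
  have h3 : 1 ≤ ∑ k, η' k ^ 2 := by rwa [Real.one_le_sqrt] at h2
  have h4 : ∑ k, η' k ^ 2 = ∑ k, η k ^ 2 - η i ^ 2 := by
    rw [← Finset.add_sum_erase _ _ (Finset.mem_univ i),
      ← Finset.add_sum_erase _ (fun k => η k ^ 2) (Finset.mem_univ i),
      Finset.sum_congr rfl (fun k hk => by
        rw [hη', Function.update_of_ne (Finset.ne_of_mem_erase hk)])]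
    simp [hη']
  rw [h4, h.unit_left] at h3
  have : η i ^ 2 = 0 := le_antisymm (by linarith) (sq_nonneg _)
  exact pow_eq_zero_iff (two_ne_zero) |>.1 this

lemma sum_sub_sq_of_unit {a b : Fin n → ℝ} (ha : ∑ i, a i ^ 2 = 1) (hb : ∑ i, b i ^ 2 = 1) :
    ∑ i, (a i - b i) ^ 2 = 2 - 2 * ∑ i, a i * b i := by
  have : ∑ i, (a i - b i) ^ 2 = ∑ i, a i ^ 2 + ∑ i, b i ^ 2 - 2 * ∑ i, a i * b i := by
    rw [Finset.mul_sum, ← Finset.sum_add_distrib, ← Finset.sum_sub_distrib]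
    exact Finset.sum_congr rfl fun i _ => by ring
  rw [this, ha, hb]; ring

lemma eq_of_one_le_sum_mul {a b : Fin n → ℝ} (ha : ∑ i, a i ^ 2 = 1) (hb : ∑ i, b i ^ 2 = 1)
    (h : 1 ≤ ∑ i, a i * b i) : a = b := by
  have h0 : ∑ i, (a i - b i) ^ 2 ≤ 0 := by
    rw [sum_sub_sq_of_unit ha hb]; linarith
  have h1 := (Finset.sum_eq_zero_iff_of_nonneg fun i _ => sq_nonneg (a i - b i)).1
    (le_antisymm h0 (Finset.sum_nonneg fun i _ => sq_nonneg _))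
  ext i
  have := pow_eq_zero_iff (two_ne_zero) |>.1 (h1 i (Finset.mem_univ i))
  linarith

lemma sum_mul_le_one {a b : Fin n → ℝ} (ha : ∑ i, a i ^ 2 = 1) (hb : ∑ i, b i ^ 2 = 1) :
    ∑ i, a i * b i ≤ 1 := by
  have : 0 ≤ ∑ i, (a i - b i) ^ 2 := Finset.sum_nonneg fun i _ => sq_nonneg _
  rw [sum_sub_sq_of_unit ha hb] at this
  linarith

lemma sqrt_mul_mul_sqrt_div {a b : ℝ} (ha : 0 ≤ a) (hb : 0 ≤ b) (h0 : a = 0 → b = 0) :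
    √(a * b) * √(b / a) = b := by
  rcases eq_or_ne a 0 with ha0 | hne
  · simp [h0 ha0]
  · have : a * b * (b / a) = b ^ 2 := by field_simp
    rw [← Real.sqrt_mul (mul_nonneg ha hb), this, Real.sqrt_sq hb]

/-- A nonzero Hermitian matrix has at most one cbB-factorization. -/
lemma IsCbBFactorization.unique [NeZero n] {X B B' : Matrix (Fin n) (Fin n) ℂ}
    {η ξ η' ξ' : Fin n → ℝ} (hX : X.IsHermitian) (hX0 : X ≠ 0)
    (h : IsCbBFactorization X η B ξ) (h' : IsCbBFactorization X η' B' ξ') :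
    η' = η ∧ B' = B ∧ ξ' = ξ := by
  have hK := h.cbBNorm_pos hX0
  have hη : ∀ i, η i = 0 ↔ η' i = 0 := fun i =>
    (h.left_eq_zero_iff hX0 i).trans (h'.left_eq_zero_iff hX0 i).symm
  have hξ : ∀ i, ξ i = 0 ↔ ξ' i = 0 := fun i =>
    ((h.conjTranspose hX).left_eq_zero_iff hX0 i).trans
      ((h'.conjTranspose hX).left_eq_zero_iff hX0 i).symm
  -- On indices where a denominator vanishes, `B` has a zero row or column, in agreement with `x / 0
  -- = 0`.
  have hB : B = diagMat (fun i => η' i / η i) * B' * diagMat (fun i => ξ' i / ξ i) := by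
    ext i j
    rw [diagMat_mul_mul_diagMat_apply]
    by_cases hi : η i = 0
    · simp [hi, h.range_le i j hi]
    by_cases hj : ξ j = 0
    · simp [hj, h.support_le i j hj]
    have e := (h.apply i j).symm.trans (h'.apply i j)
    have hi' : (η i : ℂ) ≠ 0 := Complex.ofReal_ne_zero.2 hi
    have hj' : (ξ j : ℂ) ≠ 0 := Complex.ofReal_ne_zero.2 hj
    push_cast
    field_simp
    linear_combination e
  have hnorm : opNorm (diagMat (fun i => √(η' i / η i)) * B' * diagMat (fun i => √(ξ' i / ξ i)))
      ≤ cbBNorm X := by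
    have := opNorm_sqrt_sq_le B' (d := fun i => η' i / η i) (c := fun i => ξ' i / ξ i)
      (fun i => div_nonneg (h'.nonneg_left i) (h.nonneg_left i))
      (fun i => div_nonneg (h'.nonneg_right i) (h.nonneg_right i))
    rw [← hB, h.norm_eq, h'.norm_eq, ← sq] at this
    exact (abs_le_of_sq_le_sq' this hK.le).2
  set T := diagMat (fun i => √(η' i / η i)) * B' * diagMat (fun i => √(ξ' i / ξ i)) with hT
  -- The geometric mean of the two factorizations; the equal zero sets `hη`, `hξ` cover the
  -- vanishing coordinates.
  have hfac : X = diagMat (fun i => √(η i * η' i)) * T * diagMat (fun i => √(ξ i * ξ' i)) := by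
    ext i j
    rw [diagMat_mul_mul_diagMat_apply, hT, diagMat_mul_mul_diagMat_apply, h'.apply]
    have e1 := sqrt_mul_mul_sqrt_div (h.nonneg_left i) (h'.nonneg_left i) (hη i).1
    have e2 := sqrt_mul_mul_sqrt_div (h.nonneg_right j) (h'.nonneg_right j) (hξ j).1
    conv_lhs => rw [← e1, ← e2]
    push_cast
    ring
  have hsum : ∀ {a b : Fin n → ℝ}, (∀ i, 0 ≤ a i) → (∀ i, 0 ≤ b i) →
      ∑ i, √(a i * b i) ^ 2 = ∑ i, a i * b i := fun ha hb =>
    Finset.sum_congr rfl fun i _ => Real.sq_sqrt (mul_nonneg (ha i) (hb i))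
  have h1 := cbBNorm_le T (fun i => √(η i * η' i)) (fun i => √(ξ i * ξ' i))
  rw [← hfac, hsum h.nonneg_left h'.nonneg_left, hsum h.nonneg_right h'.nonneg_right] at h1
  -- Both factors are at most one by Cauchy–Schwarz, so both equal one.
  have h2 : 1 ≤ √(∑ i, η i * η' i) * √(∑ i, ξ i * ξ' i) :=
    le_of_mul_le_mul_left (by
      rw [mul_one]; exact h1.trans (mul_le_mul_of_nonneg_right hnorm (by positivity))) hK
  have l1 : √(∑ i, η i * η' i) ≤ 1 :=
    Real.sqrt_le_one.2 (sum_mul_le_one h.unit_left h'.unit_left)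
  have l2 : √(∑ i, ξ i * ξ' i) ≤ 1 :=
    Real.sqrt_le_one.2 (sum_mul_le_one h.unit_right h'.unit_right)
  have g1 : η = η' := eq_of_one_le_sum_mul h.unit_left h'.unit_left
    (Real.one_le_sqrt.1 (h2.trans (mul_le_of_le_one_right (Real.sqrt_nonneg _) l2)))
  have g2 : ξ = ξ' := eq_of_one_le_sum_mul h.unit_right h'.unit_right
    (Real.one_le_sqrt.1 (h2.trans (mul_le_of_le_one_left (Real.sqrt_nonneg _) l1)))
  subst g1 g2
  refine ⟨rfl, ?_, rfl⟩
  ext i j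
  by_cases hi : η i = 0
  · rw [h.range_le i j hi, h'.range_le i j hi]
  by_cases hj : ξ j = 0
  · rw [h.support_le i j hj, h'.support_le i j hj]
  have e := (h'.apply i j).symm.trans (h.apply i j)
  exact mul_left_cancel₀ (Complex.ofReal_ne_zero.2 hi)
    (mul_right_cancel₀ (Complex.ofReal_ne_zero.2 hj) e)

/-! ### Finite dual solutions as pairs of positive semidefinite matrices -/

lemma proj_posSemidef (ξ : UnitVec n) : (proj ξ).PosSemidef :=
  posSemidef_vecMulVec_self_star _

lemma proj_apply_self (ξ : UnitVec n) (j : Fin n) : proj ξ j j = ((‖ξ.coord j‖ ^ 2 : ℝ) : ℂ) := by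
  rw [proj, vecMulVec_apply, Pi.star_apply, Complex.star_def, Complex.mul_conj',
    Complex.ofReal_pow]

lemma trace_proj_mul {X : Matrix (Fin n) (Fin n) ℂ} (hX : X.IsHermitian) (ξ : UnitVec n) :
    (proj ξ * X).trace = (quadForm X ξ : ℂ) := by
  have h1 : (proj ξ * X).trace = star ξ.coord ⬝ᵥ (X *ᵥ ξ.coord) := by
    rw [trace_mul_comm, proj, mul_vecMulVec, trace_vecMulVec, dotProduct_comm]
  rw [h1]
  refine Complex.ext rfl ?_
  rw [Complex.ofReal_im]
  exact hX.im_star_dotProduct_mulVec_self _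

lemma projSum_eq_sum {μ : UnitVec n → ℝ} (h : (Function.support μ).Finite) :
    projSum μ = ∑ ξ ∈ h.toFinset, (μ ξ : ℂ) • proj ξ := by
  refine finsum_eq_sum_of_support_subset _ fun ξ hξ => ?_
  simp only [Function.mem_support, Set.Finite.coe_toFinset] at hξ ⊢
  exact fun h0 => hξ (by rw [h0, Complex.ofReal_zero, zero_smul])

lemma tsum_mul_eq_sum {μ : UnitVec n → ℝ} (h : (Function.support μ).Finite) (g : UnitVec n → ℝ) :
    ∑' ξ, μ ξ * g ξ = ∑ ξ ∈ h.toFinset, μ ξ * g ξ :=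
  tsum_eq_sum fun ξ hξ => by
    rw [Set.Finite.mem_toFinset, Function.mem_support, not_not] at hξ
    rw [hξ, zero_mul]

lemma projSum_apply_self {μ : UnitVec n → ℝ} (h : (Function.support μ).Finite) (j : Fin n) :
    projSum μ j j = ((∑' ξ : UnitVec n, μ ξ * ‖ξ.coord j‖ ^ 2 : ℝ) : ℂ) := by
  rw [projSum_eq_sum h, tsum_mul_eq_sum h (fun ξ => ‖ξ.coord j‖ ^ 2), Matrix.sum_apply,
    Complex.ofReal_sum]
  refine Finset.sum_congr rfl fun ξ _ => ?_
  rw [Matrix.smul_apply, proj_apply_self, smul_eq_mul, Complex.ofReal_mul]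

lemma trace_projSum_mul {X : Matrix (Fin n) (Fin n) ℂ} (hX : X.IsHermitian) {μ : UnitVec n → ℝ}
    (h : (Function.support μ).Finite) :
    (projSum μ * X).trace = ((∑' ξ : UnitVec n, μ ξ * quadForm X ξ : ℝ) : ℂ) := by
  rw [projSum_eq_sum h, tsum_mul_eq_sum h (quadForm X), Matrix.sum_mul, trace_sum,
    Complex.ofReal_sum]
  refine Finset.sum_congr rfl fun ξ _ => ?_
  rw [smul_mul, trace_smul, trace_proj_mul hX, smul_eq_mul, Complex.ofReal_mul]

lemma trace_projSum_sub_mul {X : Matrix (Fin n) (Fin n) ℂ} (hX : X.IsHermitian)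
    {μ ν : UnitVec n → ℝ} (h : FiniteSolution μ ν) :
    ((projSum μ - projSum ν) * X).trace = (dualValue X μ ν : ℂ) := by
  rw [sub_mul, trace_sub, trace_projSum_mul hX h.1, trace_projSum_mul hX h.2, dualValue,
    Complex.ofReal_sub]

lemma projSum_posSemidef {μ : UnitVec n → ℝ} (hμ : ∀ ξ, 0 ≤ μ ξ)
    (h : (Function.support μ).Finite) : (projSum μ).PosSemidef := by
  rw [projSum_eq_sum h]
  refine posSemidef_sum _ fun ξ _ => (proj_posSemidef ξ).smul ?_
  exact Complex.zero_le_real.2 (hμ ξ)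

lemma dualFeasible_of_diag_le {μ ν : UnitVec n → ℝ} (h : FiniteSolution μ ν)
    (hμ : ∀ ξ, 0 ≤ μ ξ) (hν : ∀ ξ, 0 ≤ ν ξ)
    (hd : ∀ j, ((projSum μ + projSum ν) j j).re ≤ 1) : DualFeasible μ ν where
  nonneg_left := hμ
  nonneg_right := hν
  summable_left j := summable_of_hasFiniteSupport
    (h.1.subset fun ξ hξ h0 => hξ (by simp [h0]))
  summable_right j := summable_of_hasFiniteSupport
    (h.2.subset fun ξ hξ h0 => hξ (by simp [h0]))
  le_one j := by
    have := hd j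
    rwa [Matrix.add_apply, projSum_apply_self h.1, projSum_apply_self h.2, ← Complex.ofReal_add,
      Complex.ofReal_re] at this

lemma DualFeasible.diag_le {μ ν : UnitVec n → ℝ} (hf : DualFeasible μ ν)
    (h : FiniteSolution μ ν) (j : Fin n) : ((projSum μ + projSum ν) j j).re ≤ 1 := by
  rw [Matrix.add_apply, projSum_apply_self h.1, projSum_apply_self h.2, ← Complex.ofReal_add,
      Complex.ofReal_re]
  exact hf.le_one j

open scoped MatrixOrder in
lemma exists_eq_conjTranspose_mul_self {M : Matrix (Fin n) (Fin n) ℂ} (hM : M.PosSemidef) :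
    ∃ A : Matrix (Fin n) (Fin n) ℂ, M = Aᴴ * A :=
  CStarAlgebra.nonneg_iff_eq_star_mul_self.mp hM.nonneg

lemma conjTranspose_mul_self_apply_self_re (A : Matrix (Fin n) (Fin n) ℂ) (j : Fin n) :
    ((Aᴴ * A) j j).re = ∑ k, ‖A k j‖ ^ 2 := by
  rw [mul_apply, Complex.re_sum]
  refine Finset.sum_congr rfl fun k _ => ?_
  rw [conjTranspose_apply, Complex.star_def, Complex.conj_mul', ← Complex.ofReal_pow,
    Complex.ofReal_re]

/-- Write `M = Aᴴ A`, `N = Bᴴ B` and stack `A` over `B` on one side, `A` over `-B` on the other. The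
sign does not change the column norms, so both are controlled by the diagonal of `M + N`. -/
lemma schurNorm_sub_le {M N : Matrix (Fin n) (Fin n) ℂ} (hM : M.PosSemidef) (hN : N.PosSemidef)
    {c : ℝ} (hc : 0 ≤ c) (hd : ∀ j, ((M + N) j j).re ≤ c) : schurNorm (M - N) ≤ c := by
  obtain ⟨A, rfl⟩ := exists_eq_conjTranspose_mul_self hM
  obtain ⟨B, rfl⟩ := exists_eq_conjTranspose_mul_self hN
  have hcol : ∀ j, ∑ k, ‖A k j‖ ^ 2 + ∑ k, ‖B k j‖ ^ 2 ≤ c := by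
    intro j
    have := hd j
    rwa [Matrix.add_apply, Complex.add_re, conjTranspose_mul_self_apply_self_re,
      conjTranspose_mul_self_apply_self_re] at this
  refine schurNorm_le hc (L := fun k i => Sum.elim (fun k => A k i) (fun k => B k i) k)
    (R := fun k j => Sum.elim (fun k => A k j) (fun k => -B k j) k)
    (fun i j => ?_) (fun j => ?_) (fun j => ?_)
  · simp [mul_apply, sub_eq_add_neg]
  · simpa using hcol j
  · simpa using hcol j

lemma schurNorm_le_of_posSemidef {M : Matrix (Fin n) (Fin n) ℂ} (hM : M.PosSemidef)
    {c : ℝ} (hc : 0 ≤ c) (hd : ∀ j, (M j j).re ≤ c) : schurNorm M ≤ c := by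
  have := schurNorm_sub_le hM (PosSemidef.zero (n := Fin n) (R := ℂ)) hc (by simpa using hd)
  rwa [sub_zero] at this

/-! ### Weak duality and spectral decompositions -/

/-- Weak duality. -/
lemma DualFeasible.dualValue_le {X : Matrix (Fin n) (Fin n) ℂ} {l : Fin n → ℝ}
    {μ ν : UnitVec n → ℝ} (hd : DualFeasible μ ν) (hp : PrimalFeasible X l) :
    dualValue X μ ν ≤ ∑ j, l j := by
  -- The support may be infinite: the primal constraints dominate the objective series by a summable
  -- one, which permits the interchange of sums.
  have aux : ∀ {ρ : UnitVec n → ℝ} {q : UnitVec n → ℝ}, (∀ ξ, 0 ≤ ρ ξ) →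
      (∀ j, Summable fun ξ : UnitVec n => ρ ξ * ‖ξ.coord j‖ ^ 2) →
      (∀ ξ, |q ξ| ≤ ∑ j, l j * ‖ξ.coord j‖ ^ 2) →
      ∑' ξ, ρ ξ * q ξ ≤ ∑ j, l j * ∑' ξ : UnitVec n, ρ ξ * ‖ξ.coord j‖ ^ 2 := by
    intro ρ q hρ hs hq
    have e : ∀ ξ : UnitVec n, ρ ξ * ∑ j, l j * ‖ξ.coord j‖ ^ 2 =
        ∑ j, l j * (ρ ξ * ‖ξ.coord j‖ ^ 2) := fun ξ => by
      rw [Finset.mul_sum]; exact Finset.sum_congr rfl fun j _ => by ring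
    have hs' : Summable fun ξ : UnitVec n => ρ ξ * ∑ j, l j * ‖ξ.coord j‖ ^ 2 := by
      simp only [e]
      exact summable_sum fun j _ => (hs j).mul_left _
    have hsq : Summable fun ξ => ρ ξ * q ξ := by
      refine hs'.of_norm_bounded fun ξ => ?_
      rw [norm_mul, Real.norm_of_nonneg (hρ ξ)]
      exact mul_le_mul_of_nonneg_left (hq ξ) (hρ ξ)
    refine (hsq.tsum_le_tsum (fun ξ => mul_le_mul_of_nonneg_left
      ((le_abs_self _).trans (hq ξ)) (hρ ξ)) hs').trans (le_of_eq ?_)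
    simp only [e]
    rw [Summable.tsum_finsetSum fun j _ => (hs j).mul_left _]
    exact Finset.sum_congr rfl fun j _ => tsum_mul_left
  have hq : ∀ ξ, |quadForm X ξ| ≤ ∑ j, l j * ‖ξ.coord j‖ ^ 2 := fun ξ =>
    abs_le'.2 ⟨hp.upper ξ, hp.lower ξ⟩
  have h1 := aux hd.nonneg_left hd.summable_left hq
  have h2 := aux hd.nonneg_right hd.summable_right (q := fun ξ => -quadForm X ξ)
    (fun ξ => by rw [abs_neg]; exact hq ξ)
  simp only [mul_neg, tsum_neg] at h2
  rw [dualValue, sub_eq_add_neg]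
  refine (add_le_add h1 h2).trans ?_
  rw [← Finset.sum_add_distrib]
  refine Finset.sum_le_sum fun j _ => ?_
  rw [← mul_add]
  exact mul_le_of_le_one_right (hp.nonneg j) (hd.le_one j)

lemma exists_isSpectralDecomposition {M : Matrix (Fin n) (Fin n) ℂ} (hM : M.PosSemidef) :
    ∃ μ : UnitVec n → ℝ, IsSpectralDecomposition M μ := by
  classical
  set b := hM.1.eigenvectorBasis with hb
  set e : Fin n → UnitVec n := fun s => ⟨b s, by simp⟩ with he
  have hinj : Function.Injective e := fun s t hst =>
    b.orthonormal.linearIndependent.injective (congrArg Subtype.val hst)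
  -- Zero eigenvalues drop out of the support, which leaves only the positive ones.
  set μ : UnitVec n → ℝ := Function.extend e hM.1.eigenvalues 0 with hμ
  have hμe : ∀ s, μ (e s) = hM.1.eigenvalues s := fun s => hinj.extend_apply _ _ _
  have hsupp : Function.support μ ⊆ Set.range e := by
    intro ξ hξ
    by_contra hn
    exact hξ (by rw [hμ, Function.extend_apply' _ _ _ hn, Pi.zero_apply])
  have hfin : (Function.support μ).Finite := (Set.finite_range e).subset hsupp
  refine ⟨μ, ?_, hfin, ?_, ?_⟩
  · intro ξ
    by_cases hξ : ∃ s, e s = ξ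
    · obtain ⟨s, rfl⟩ := hξ
      rw [hμe]; exact hM.eigenvalues_nonneg s
    · rw [hμ, Function.extend_apply' _ _ _ hξ, Pi.zero_apply]
  · have hg : ∀ ξ : Function.support μ, ∃ s, e s = ξ := fun ξ => hsupp ξ.2
    choose g hg using hg
    have hg' : (fun ξ : Function.support μ => ((ξ : UnitVec n) : EuclideanSpace ℂ (Fin n))) =
        b ∘ g := by
      ext1 ξ
      rw [← hg ξ]; rfl
    rw [hg']
    refine b.orthonormal.comp g fun ξ ζ h => Subtype.ext ?_
    rw [← hg ξ, ← hg ζ, h]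
  · have h1 : projSum μ = ∑ s, (hM.1.eigenvalues s : ℂ) • proj (e s) := by
      rw [projSum, finsum_eq_sum_of_support_subset (s := Finset.univ.image e),
        Finset.sum_image fun s _ t _ h => hinj h]
      · exact Finset.sum_congr rfl fun s _ => by rw [hμe]
      · intro ξ hξ
        obtain ⟨s, rfl⟩ := hsupp (fun h0 => hξ (by
          simp only [h0, Complex.ofReal_zero, zero_smul]) : ξ ∈ Function.support μ)
        simp
    rw [h1]
    ext i j
    conv_lhs => rw [hM.1.spectral_theorem, Unitary.conjStarAlgAut_apply]
    rw [Matrix.sum_apply, mul_apply]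
    refine Finset.sum_congr rfl fun s _ => ?_
    rw [mul_diagonal, Matrix.smul_apply, proj, vecMulVec_apply, star_apply, Pi.star_apply,
      smul_eq_mul]
    change _ * (hM.1.eigenvalues s : ℂ) * _ = _ * (b s i * star (b s j))
    rw [hM.1.eigenvectorUnitary_apply, hM.1.eigenvectorUnitary_apply]
    ring

/-! ### Strong duality -/

/-- The objective of the dual program in terms of `M = ∑ μ_ξ P_ξ` and `N = ∑ ν_η P_η`. -/
noncomputable def dualObjective (X M N : Matrix (Fin n) (Fin n) ℂ) : ℝ := (((M - N) * X).trace).re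

lemma dualObjective_add (X M N M' N' : Matrix (Fin n) (Fin n) ℂ) :
    dualObjective X (M + M') (N + N') = dualObjective X M N + dualObjective X M' N' := by
  rw [dualObjective, dualObjective, dualObjective, ← Complex.add_re, ← trace_add, ← add_mul]
  congr 3
  abel

lemma dualObjective_smul (X M N : Matrix (Fin n) (Fin n) ℂ) (c : ℝ) :
    dualObjective X ((c : ℂ) • M) ((c : ℂ) • N) = c * dualObjective X M N := by
  rw [dualObjective, dualObjective, ← smul_sub, smul_mul, trace_smul, smul_eq_mul,
    Complex.re_ofReal_mul]

/-- The maximum of the dual program over pairs of positive semidefinite matrices is attained. -/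
lemma exists_isMax_dualObjective (X : Matrix (Fin n) (Fin n) ℂ) :
    ∃ M N : Matrix (Fin n) (Fin n) ℂ, M.PosSemidef ∧ N.PosSemidef ∧
      (∀ j, ((M + N) j j).re ≤ 1) ∧
      ∀ M' N' : Matrix (Fin n) (Fin n) ℂ, M'.PosSemidef → N'.PosSemidef →
        (∀ j, ((M' + N') j j).re ≤ 1) → dualObjective X M' N' ≤ dualObjective X M N := by
  -- Compactness is checked on factors `(A, B)` with `M = Aᴴ A`, `N = Bᴴ B`, where the constraint
  -- bounds the columns.
  set S : Set ((Fin n → Fin n → ℂ) × (Fin n → Fin n → ℂ)) :=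
    {p | ∀ j, ∑ k, ‖p.1 k j‖ ^ 2 + ∑ k, ‖p.2 k j‖ ^ 2 ≤ 1} with hS
  have hdiag : ∀ (A B : Matrix (Fin n) (Fin n) ℂ) (j : Fin n), ((Aᴴ * A + Bᴴ * B) j j).re =
      ∑ k, ‖A k j‖ ^ 2 + ∑ k, ‖B k j‖ ^ 2 := by
    intro A B j
    rw [Matrix.add_apply, Complex.add_re, conjTranspose_mul_self_apply_self_re,
      conjTranspose_mul_self_apply_self_re]
  have hclosed : IsClosed S := by
    simp only [hS, Set.ofPred_forall]
    refine isClosed_iInter fun j => isClosed_le (by fun_prop) continuous_const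
  have hle : ∀ p ∈ S, ‖p‖ ≤ 1 := by
    intro p hp
    have h1 : ∀ (W : Fin n → Fin n → ℂ), (∀ j, ∑ k, ‖W k j‖ ^ 2 ≤ 1) → ‖W‖ ≤ 1 := by
      intro W hW
      refine (pi_norm_le_iff_of_nonneg zero_le_one).2 fun k =>
        (pi_norm_le_iff_of_nonneg zero_le_one).2 fun j => ?_
      have := (Finset.single_le_sum (f := fun k => ‖W k j‖ ^ 2) (fun k _ => by positivity)
        (Finset.mem_univ k)).trans (hW j)
      exact (sq_le_one_iff₀ (norm_nonneg _)).1 this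
    refine Prod.norm_def p ▸ max_le (h1 _ fun j => ?_) (h1 _ fun j => ?_)
    · exact le_trans (le_add_of_nonneg_right (by positivity)) (hp j)
    · exact le_trans (le_add_of_nonneg_left (by positivity)) (hp j)
  have hcomp : IsCompact S := Metric.isCompact_of_isClosed_isBounded hclosed
    (isBounded_iff_forall_norm_le.2 ⟨1, hle⟩)
  have hcont : Continuous fun p : (Fin n → Fin n → ℂ) × (Fin n → Fin n → ℂ) =>
      dualObjective X ((of p.1)ᴴ * of p.1) ((of p.2)ᴴ * of p.2) := by
    unfold dualObjective
    have h1 : Continuous fun p : (Fin n → Fin n → ℂ) × (Fin n → Fin n → ℂ) => of p.1 :=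
      continuous_fst
    have h2 : Continuous fun p : (Fin n → Fin n → ℂ) × (Fin n → Fin n → ℂ) => of p.2 :=
      continuous_snd
    exact Complex.continuous_re.comp ((((h1.matrix_conjTranspose.matrix_mul h1).sub
      (h2.matrix_conjTranspose.matrix_mul h2)).matrix_mul continuous_const).matrix_trace)
  obtain ⟨p, hp, hmax⟩ := hcomp.exists_isMaxOn ⟨0, by intro j; simp⟩ hcont.continuousOn
  refine ⟨_, _, posSemidef_conjTranspose_mul_self (of p.1), posSemidef_conjTranspose_mul_self
    (of p.2), fun j => (hdiag _ _ j).trans_le (hp j), fun M' N' hM' hN' hd => ?_⟩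
  obtain ⟨A, rfl⟩ := exists_eq_conjTranspose_mul_self hM'
  obtain ⟨B, rfl⟩ := exists_eq_conjTranspose_mul_self hN'
  exact hmax (a := (A, B)) fun j => (hdiag A B j).symm.trans_le (hd j)

lemma eq_zero_of_diag_eq_zero {M N : Matrix (Fin n) (Fin n) ℂ} (hM : M.PosSemidef)
    (hN : N.PosSemidef) (h : ∀ j, ((M + N) j j).re ≤ 0) : M = 0 ∧ N = 0 := by
  obtain ⟨A, rfl⟩ := exists_eq_conjTranspose_mul_self hM
  obtain ⟨B, rfl⟩ := exists_eq_conjTranspose_mul_self hN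
  have h' : ∀ j, ∑ k, ‖A k j‖ ^ 2 + ∑ k, ‖B k j‖ ^ 2 ≤ 0 := by
    intro j
    have := h j
    rwa [Matrix.add_apply, Complex.add_re, conjTranspose_mul_self_apply_self_re,
      conjTranspose_mul_self_apply_self_re] at this
  have key : ∀ (W : Matrix (Fin n) (Fin n) ℂ), (∀ j, ∑ k, ‖W k j‖ ^ 2 ≤ 0) → W = 0 := by
    intro W hW
    ext k j
    have := (Finset.single_le_sum (f := fun k => ‖W k j‖ ^ 2) (fun k _ => by positivity)
      (Finset.mem_univ k)).trans (hW j)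
    simpa using le_antisymm this (by positivity)
  have hA : A = 0 := key A fun j => le_trans (le_add_of_nonneg_right (by positivity)) (h' j)
  have hB : B = 0 := key B fun j => le_trans (le_add_of_nonneg_left (by positivity)) (h' j)
  simp [hA, hB]

/-- The homogeneous form of a bound on the dual program. -/
lemma exists_dualObjective_le [NeZero n] {X : Matrix (Fin n) (Fin n) ℂ} {D : ℝ}
    (hD : ∀ M N : Matrix (Fin n) (Fin n) ℂ, M.PosSemidef → N.PosSemidef →
      (∀ j, ((M + N) j j).re ≤ 1) → dualObjective X M N ≤ D)
    {M N : Matrix (Fin n) (Fin n) ℂ} (hM : M.PosSemidef) (hN : N.PosSemidef) :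
    ∃ j, dualObjective X M N ≤ D * ((M + N) j j).re := by
  obtain ⟨j, -, hj⟩ := Finset.exists_max_image Finset.univ (fun j => ((M + N) j j).re)
    ⟨0, Finset.mem_univ _⟩
  refine ⟨j, ?_⟩
  set m := ((M + N) j j).re with hm
  -- `m` is the largest diagonal entry of `M + N`; if it is positive, dividing by it makes the pair
  -- feasible.
  rcases le_or_gt m 0 with h0 | h0
  · obtain ⟨rfl, rfl⟩ := eq_zero_of_diag_eq_zero hM hN
      fun k => (hj k (Finset.mem_univ k)).trans h0
    simp [dualObjective, hm]
  · have hc : (0 : ℂ) ≤ ((m⁻¹ : ℝ) : ℂ) := Complex.zero_le_real.2 (by positivity)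
    have := hD _ _ (hM.smul hc) (hN.smul hc) (fun k => by
      rw [← smul_add, Matrix.smul_apply, smul_eq_mul, Complex.re_ofReal_mul, inv_mul_le_iff₀ h0,
        mul_one]
      exact hj k (Finset.mem_univ k))
    rw [dualObjective_smul, inv_mul_le_iff₀ h0] at this
    linarith

/-- A convex cone of vectors, none of which has all coordinates negative, lies in a half space
with a nonnegative normal vector. -/
lemma exists_nonneg_functional [NeZero n] {K : Set (Fin n → ℝ)} (hK : Convex ℝ K) (h0 : 0 ∈ K)
    (hneg : ∀ w ∈ K, ∃ j, 0 ≤ w j) :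
    ∃ p : Fin n → ℝ, (∀ j, 0 ≤ p j) ∧ ∑ j, p j = 1 ∧ ∀ w ∈ K, 0 ≤ ∑ j, p j * w j := by
  set s : Set (Fin n → ℝ) := Set.univ.pi fun _ => Set.Iio 0 with hs
  have hmem : ∀ {x : Fin n → ℝ}, (∀ j, x j < 0) → x ∈ s := fun h j _ => h j
  have hdisj : Disjoint s K := Set.disjoint_left.2 fun x hx hxK => by
    obtain ⟨j, hj⟩ := hneg x hxK
    exact absurd (hx j (Set.mem_univ j)) (not_lt.2 hj)
  obtain ⟨f, u, hf, hu⟩ := geometric_hahn_banach_open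
    (convex_pi fun _ _ => convex_Iio 0) (isOpen_set_pi Set.finite_univ fun _ _ => isOpen_Iio)
    hK hdisj
  have hu0 : u ≤ 0 := by simpa using hu 0 h0
  have hF : 0 < f 1 := by
    have := hf (-1) (hmem fun j => by simp)
    rw [map_neg] at this
    linarith
  have hu1 : 0 ≤ u := by
    by_contra! hlt
    have := hf ((u / f 1) • 1) (hmem fun j => by
      simpa using div_neg_of_neg_of_pos hlt hF)
    rw [map_smul, smul_eq_mul, div_mul_cancel₀ _ hF.ne'] at this
    exact lt_irrefl _ this
  have hp : ∀ j, 0 ≤ f (Pi.single j 1) := by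
    intro j
    by_contra! hlt
    -- If `f` were negative on a basis vector, this point would lie in the open negative orthant
    -- with `f`-value zero, contrary to `f < u ≤ 0` there.
    have := hf (-Pi.single j 1 + (f (Pi.single j 1) / f 1) • 1) (hmem fun k => by
      have h1 : (0 : ℝ) ≤ (Pi.single j 1 : Fin n → ℝ) k := by
        by_cases hk : k = j
        · subst hk; simp
        · simp [hk]
      have h2 := div_neg_of_neg_of_pos hlt hF
      simp only [Pi.add_apply, Pi.neg_apply, Pi.smul_apply, Pi.one_apply, smul_eq_mul, mul_one]
      linarith)
    rw [map_add, map_neg, map_smul, smul_eq_mul, div_mul_cancel₀ _ hF.ne'] at this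
    linarith
  have hsum : ∀ w : Fin n → ℝ, f w = ∑ j, f (Pi.single j 1) * w j := by
    intro w
    conv_lhs => rw [pi_eq_sum_univ' w]
    rw [map_sum]
    refine Finset.sum_congr rfl fun j _ => ?_
    rw [map_smul, smul_eq_mul, mul_comm]
  refine ⟨fun j => f (Pi.single j 1) / f 1, fun j => div_nonneg (hp j) hF.le, ?_, fun w hw => ?_⟩
  · rw [← Finset.sum_div, div_eq_one_iff_eq hF.ne', hsum 1]
    simp
  · have : ∑ j, f (Pi.single j 1) / f 1 * w j = f w / f 1 := by
      rw [hsum w, Finset.sum_div]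
      exact Finset.sum_congr rfl fun j _ => by ring
    rw [this]
    exact div_nonneg (hu1.trans (hu w hw)) hF.le

/-- Strong duality: a bound on the dual program is the value of a feasible primal solution. -/
lemma exists_primalFeasible [NeZero n] {X : Matrix (Fin n) (Fin n) ℂ} (hX : X.IsHermitian) {D : ℝ}
    (hD : ∀ M N : Matrix (Fin n) (Fin n) ℂ, M.PosSemidef → N.PosSemidef →
      (∀ j, ((M + N) j j).re ≤ 1) → dualObjective X M N ≤ D) :
    ∃ l, PrimalFeasible X l ∧ ∑ j, l j = D := by
  have hD0 : 0 ≤ D := by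
    simpa [dualObjective] using hD 0 0 PosSemidef.zero PosSemidef.zero (by simp)
  -- Slack vectors of the homogenized bound. By `exists_dualObjective_le` none is negative in every
  -- coordinate; the separating weights `p` give `l = D p`, and rank-one pairs recover the primal
  -- constraints.
  set w : Matrix (Fin n) (Fin n) ℂ → Matrix (Fin n) (Fin n) ℂ → Fin n → ℝ :=
    fun M N j => D * ((M + N) j j).re - dualObjective X M N with hw
  obtain ⟨p, hp0, hp1, hp⟩ := exists_nonneg_functional
    (K := {x | ∃ M N : Matrix (Fin n) (Fin n) ℂ, M.PosSemidef ∧ N.PosSemidef ∧ x = w M N})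
    (by
      rintro _ ⟨M, N, hM, hN, rfl⟩ _ ⟨M', N', hM', hN', rfl⟩ a b ha hb -
      have ha' : (0 : ℂ) ≤ (a : ℂ) := Complex.zero_le_real.2 ha
      have hb' : (0 : ℂ) ≤ (b : ℂ) := Complex.zero_le_real.2 hb
      refine ⟨(a : ℂ) • M + (b : ℂ) • M', (a : ℂ) • N + (b : ℂ) • N',
        (hM.smul ha').add (hM'.smul hb'), (hN.smul ha').add (hN'.smul hb'), ?_⟩
      ext j
      simp only [hw, dualObjective_add, dualObjective_smul, Pi.add_apply, Pi.smul_apply,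
        smul_eq_mul, Matrix.add_apply, Matrix.smul_apply, Complex.add_re, Complex.re_ofReal_mul]
      ring)
    ⟨0, 0, PosSemidef.zero, PosSemidef.zero, by ext j; simp [hw, dualObjective]⟩
    (by
      rintro _ ⟨M, N, hM, hN, rfl⟩
      obtain ⟨j, hj⟩ := exists_dualObjective_le hD hM hN
      exact ⟨j, sub_nonneg.2 hj⟩)
  have key : ∀ M N : Matrix (Fin n) (Fin n) ℂ, M.PosSemidef → N.PosSemidef →
      dualObjective X M N ≤ ∑ j, D * p j * ((M + N) j j).re := by
    intro M N hM hN
    have := hp _ ⟨M, N, hM, hN, rfl⟩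
    simp only [hw, mul_sub, Finset.sum_sub_distrib, ← Finset.sum_mul, hp1, one_mul] at this
    refine (sub_nonneg.1 this).trans (le_of_eq ?_)
    exact Finset.sum_congr rfl fun j _ => by ring
  refine ⟨fun j => D * p j, ⟨fun j => mul_nonneg hD0 (hp0 j), fun ξ => ?_, fun ξ => ?_⟩, ?_⟩
  · have := key (proj ξ) 0 (proj_posSemidef ξ) PosSemidef.zero
    simpa only [dualObjective, sub_zero, trace_proj_mul hX, add_zero, proj_apply_self,
      Complex.ofReal_re] using this
  · have := key 0 (proj ξ) PosSemidef.zero (proj_posSemidef ξ)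
    simpa only [dualObjective, zero_sub, neg_mul, trace_neg, trace_proj_mul hX, zero_add,
      proj_apply_self, Complex.ofReal_re, Complex.neg_re] using this
  · rw [← Finset.mul_sum, hp1, mul_one]

/-- The value of a finite feasible dual solution is at most the cbB-norm. -/
lemma dualObjective_le_cbBNorm (X : Matrix (Fin n) (Fin n) ℂ) {M N : Matrix (Fin n) (Fin n) ℂ}
    (hM : M.PosSemidef) (hN : N.PosSemidef) (hd : ∀ j, ((M + N) j j).re ≤ 1) :
    dualObjective X M N ≤ cbBNorm X := by
  have h := norm_trace_le_cbBNorm X (schurNorm_sub_le hM hN zero_le_one hd)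
  rw [(hM.1.sub hN.1).eq] at h
  exact (Complex.re_le_norm _).trans h

/-! ### Attainment and its consequences -/

lemma IsSpectralDecomposition.finiteSolution {M N : Matrix (Fin n) (Fin n) ℂ}
    {μ ν : UnitVec n → ℝ} (hμ : IsSpectralDecomposition M μ) (hν : IsSpectralDecomposition N ν) :
    FiniteSolution μ ν := ⟨hμ.finite, hν.finite⟩

lemma IsSpectralDecomposition.dualFeasible {M N : Matrix (Fin n) (Fin n) ℂ}
    {μ ν : UnitVec n → ℝ} (hμ : IsSpectralDecomposition M μ) (hν : IsSpectralDecomposition N ν)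
    (hd : ∀ j, ((M + N) j j).re ≤ 1) : DualFeasible μ ν :=
  dualFeasible_of_diag_le (hμ.finiteSolution hν) hμ.nonneg hν.nonneg
    (by rwa [← hμ.eq_sum, ← hν.eq_sum])

lemma IsSpectralDecomposition.trace_sub_mul {X M N : Matrix (Fin n) (Fin n) ℂ}
    (hX : X.IsHermitian) {μ ν : UnitVec n → ℝ} (hμ : IsSpectralDecomposition M μ)
    (hν : IsSpectralDecomposition N ν) : ((M - N) * X).trace = (dualValue X μ ν : ℂ) := by
  rw [← trace_projSum_sub_mul hX (hμ.finiteSolution hν), ← hμ.eq_sum, ← hν.eq_sum]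

/-- Both programs attain the cbB-norm, the dual one at a finite solution. -/
lemma exists_optimal [NeZero n] {X : Matrix (Fin n) (Fin n) ℂ} (hX : X.IsHermitian) :
    (∃ l, PrimalFeasible X l ∧ ∑ j, l j = cbBNorm X) ∧
    ∃ μ ν : UnitVec n → ℝ, FiniteSolution μ ν ∧ DualFeasible μ ν ∧
      dualValue X μ ν = cbBNorm X := by
  obtain ⟨M, N, hM, hN, hd, hmax⟩ := exists_isMax_dualObjective X
  obtain ⟨l, hl, hsum⟩ := exists_primalFeasible hX hmax
  have hval : dualObjective X M N = cbBNorm X :=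
    le_antisymm (dualObjective_le_cbBNorm X hM hN hd) (hsum ▸ hl.cbBNorm_le_sum hX)
  obtain ⟨μ, hμ⟩ := exists_isSpectralDecomposition hM
  obtain ⟨ν, hν⟩ := exists_isSpectralDecomposition hN
  refine ⟨⟨l, hl, hsum.trans hval⟩, μ, ν, hμ.finiteSolution hν, hμ.dualFeasible hν hd, ?_⟩
  rw [← hval, dualObjective, hμ.trace_sub_mul hX hν, Complex.ofReal_re]

lemma DualFeasible.dualValue_le_cbBNorm [NeZero n] {X : Matrix (Fin n) (Fin n) ℂ}
    (hX : X.IsHermitian) {μ ν : UnitVec n → ℝ} (h : DualFeasible μ ν) :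
    dualValue X μ ν ≤ cbBNorm X := by
  obtain ⟨⟨l, hl, hsum⟩, -⟩ := exists_optimal hX
  exact hsum ▸ h.dualValue_le hl

lemma DualOptimal.dualValue_eq [NeZero n] {X : Matrix (Fin n) (Fin n) ℂ}
    (hX : X.IsHermitian) {μ ν : UnitVec n → ℝ} (h : DualOptimal X μ ν) :
    dualValue X μ ν = cbBNorm X := by
  obtain ⟨-, μ', ν', -, hf, hv⟩ := exists_optimal hX
  exact le_antisymm (h.1.dualValue_le_cbBNorm hX) (hv ▸ h.2 μ' ν' hf)

lemma cbBNorm_pos [NeZero n] {X : Matrix (Fin n) (Fin n) ℂ} (hX : X.IsHermitian) (hX0 : X ≠ 0) :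
    0 < cbBNorm X := by
  refine lt_of_le_of_ne (cbBNorm_nonneg X) fun h0 => hX0 ?_
  obtain ⟨⟨l, hl, hsum⟩, -⟩ := exists_optimal hX
  rw [← h0, Finset.sum_eq_zero_iff_of_nonneg fun j _ => hl.nonneg j] at hsum
  ext i j
  exact hl.apply_eq_zero hX (hsum i (Finset.mem_univ i)) j

lemma exists_isCbBFactorization [NeZero n] {X : Matrix (Fin n) (Fin n) ℂ} (hX : X.IsHermitian) :
    ∃ (B : Matrix (Fin n) (Fin n) ℂ) (ξ : Fin n → ℝ),
      IsCbBFactorization X ξ B ξ ∧ B.IsHermitian := by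
  rcases eq_or_ne X 0 with rfl | hX0
  -- For `X = 0` any nonnegative unit vector works with middle matrix zero.
  · refine ⟨0, Pi.single 0 1, ⟨fun i => ?_, fun i => ?_, ?_, ?_, by simp, ?_, by simp, by simp⟩,
      isHermitian_zero⟩
    · by_cases hi : i = 0 <;> simp [hi]
    · by_cases hi : i = 0 <;> simp [hi]
    · simp [Pi.single_apply]
    · simp [Pi.single_apply]
    · rw [opNorm_zero, cbBNorm_zero]
  · obtain ⟨⟨l, hl, hsum⟩, -⟩ := exists_optimal hX
    refine ⟨_, _, isCbBFactorization_of_primal hX hl hsum (cbBNorm_pos hX hX0), ?_⟩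
    rw [IsHermitian, conjTranspose_smul, (normalized_isHermitian hX l).eq]
    simp

lemma IsCbBFactorization.primalOptimal [NeZero n] {X B : Matrix (Fin n) (Fin n) ℂ}
    {η ξ : Fin n → ℝ} (hX : X.IsHermitian) (h : IsCbBFactorization X η B ξ) :
    PrimalOptimal X (fun j => cbBNorm X * ξ j ^ 2) := by
  have hsum : ∑ j, cbBNorm X * ξ j ^ 2 = cbBNorm X := by
    rw [← Finset.mul_sum, h.unit_right, mul_one]
  refine ⟨?_, fun l' hl' => hsum.trans_le (hl'.cbBNorm_le_sum hX)⟩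
  rcases eq_or_ne X 0 with rfl | hX0
  · refine ⟨fun j => ?_, fun ζ => ?_, fun ζ => ?_⟩ <;> simp [cbBNorm_zero, quadForm]
  -- The adjoint factorization swaps the outer vectors, so uniqueness identifies them.
  have hηξ : η = ξ := (((h.conjTranspose hX).unique hX hX0 h)).1
  subst hηξ
  have key : ∀ ζ : UnitVec n, |quadForm X ζ| ≤ ∑ j, cbBNorm X * η j ^ 2 * ‖ζ.coord j‖ ^ 2 := by
    intro ζ
    have e : star ζ.coord ⬝ᵥ (X *ᵥ ζ.coord) = star (fun i => (η i : ℂ) * ζ.coord i) ⬝ᵥ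
        (B *ᵥ (fun j => (η j : ℂ) * ζ.coord j)) := by
      rw [← dotProduct_diagMat_mul_mul_diagMat, ← h.factor]
    rw [quadForm, e]
    refine (Complex.abs_re_le_norm _).trans ((norm_dotProduct_mulVec_le _ _ _).trans ?_)
    rw [h.norm_eq, ← sq, norm_toLp_sq, Finset.mul_sum]
    refine Finset.sum_le_sum fun j _ => le_of_eq ?_
    rw [norm_mul, Complex.norm_real, mul_pow, Real.norm_eq_abs, sq_abs, mul_assoc]
  exact ⟨fun j => mul_nonneg (cbBNorm_nonneg X) (sq_nonneg _),
    fun ζ => (abs_le'.1 (key ζ)).1, fun ζ => (abs_le'.1 (key ζ)).2⟩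

/-! ### Self-adjoint Schur factorizations and norming matrices -/

section SchurFactorization

variable {Y E S : Matrix (Fin n) (Fin n) ℂ}

lemma posProj_isHermitian (hS : S.IsHermitian) : (posProj S)ᴴ = posProj S := by
  simp [posProj, conjTranspose_smul, hS.eq]

lemma negProj_isHermitian (hS : S.IsHermitian) : (negProj S)ᴴ = negProj S := by
  simp [negProj, conjTranspose_smul, hS.eq]

lemma posProj_mul_self (hS : S * S = 1) : posProj S * posProj S = posProj S := by
  rw [posProj, smul_mul, Matrix.mul_smul, smul_smul]
  simp only [add_mul, mul_add, one_mul, mul_one, hS]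
  module

lemma negProj_mul_self (hS : S * S = 1) : negProj S * negProj S = negProj S := by
  rw [negProj, smul_mul, Matrix.mul_smul, smul_smul]
  simp only [sub_mul, mul_sub, one_mul, mul_one, hS]
  module

lemma posSemidef_mul_mul_of_isProj {F : Matrix (Fin n) (Fin n) ℂ} (hE : E.IsHermitian)
    (hF : Fᴴ = F) (hFF : F * F = F) : (E * F * E).PosSemidef := by
  have : E * F * E = (F * E)ᴴ * (F * E) := by
    rw [conjTranspose_mul, hF, hE.eq, ← mul_assoc, mul_assoc E F F, hFF]
  rw [this]
  exact posSemidef_conjTranspose_mul_self _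

lemma IsSelfAdjointSchurFactorization.mul_self (h : IsSelfAdjointSchurFactorization Y E S) :
    S * S = 1 := by
  have := h.isometry
  rwa [h.selfAdjoint.eq] at this

lemma IsSelfAdjointSchurFactorization.posSemidef_posPart
    (h : IsSelfAdjointSchurFactorization Y E S) : (E * posProj S * E).PosSemidef :=
  posSemidef_mul_mul_of_isProj h.posSemidef.1 (posProj_isHermitian h.selfAdjoint)
    (posProj_mul_self h.mul_self)

lemma IsSelfAdjointSchurFactorization.posSemidef_negPart
    (h : IsSelfAdjointSchurFactorization Y E S) : (E * negProj S * E).PosSemidef :=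
  posSemidef_mul_mul_of_isProj h.posSemidef.1 (negProj_isHermitian h.selfAdjoint)
    (negProj_mul_self h.mul_self)

lemma mul_posProj_add_mul_negProj : E * posProj S * E + E * negProj S * E = E * E := by
  have : posProj S + negProj S = 1 := by rw [posProj, negProj]; module
  rw [← add_mul, ← mul_add, this, mul_one]

lemma mul_posProj_sub_mul_negProj : E * posProj S * E - E * negProj S * E = E * S * E := by
  have : posProj S - negProj S = S := by rw [posProj, negProj]; module
  rw [← sub_mul, ← mul_sub, this]

end SchurFactorization

/-- A difference of Hermitian matrices that norms `X` has Schur multiplier norm at least one. -/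
lemma one_le_of_schurNorm_sub_le {X M N : Matrix (Fin n) (Fin n) ℂ} (hK : 0 < cbBNorm X)
    (hM : M.IsHermitian) (hN : N.IsHermitian) (htr : ((M - N) * X).trace = (cbBNorm X : ℂ))
    {c : ℝ} (hc0 : 0 ≤ c) (hc : schurNorm (M - N) ≤ c) : 1 ≤ c := by
  -- The margin `ε` keeps the scaling constant positive, as `c = 0` is not yet excluded.
  refine le_of_forall_pos_le_add fun ε hε => ?_
  have h := norm_trace_le_mul_cbBNorm X (Y := M - N) (c := c + ε) (by linarith) (by linarith)
  rw [(hM.sub hN).eq, htr, Complex.norm_real, Real.norm_of_nonneg hK.le] at h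
  exact le_of_mul_le_mul_right (by rwa [one_mul]) hK

end SchurLP

open SchurLP in
theorem theorem4p4 (n : ℕ) (hn : 0 < n) (X : Matrix (Fin n) (Fin n) ℂ) (hX : X.IsHermitian) :
    -- the optimal values of both programs
    IsLeast (primalValues X) (cbBNorm X) ∧
    IsGreatest (dualValues X) (cbBNorm X) ∧
    (∃ μ ν : UnitVec n → ℝ, FiniteSolution μ ν ∧ DualOptimal X μ ν) ∧
    -- the cbB-factorization and the optimal primal solution that it gives
    (∃ (B : Matrix (Fin n) (Fin n) ℂ) (ξ : Fin n → ℝ),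
      IsCbBFactorization X ξ B ξ ∧ B.IsHermitian ∧
      (X ≠ 0 → ∀ (η' : Fin n → ℝ) (B' : Matrix (Fin n) (Fin n) ℂ) (ξ' : Fin n → ℝ),
        IsCbBFactorization X η' B' ξ' → η' = ξ ∧ B' = B ∧ ξ' = ξ)) ∧
    (∀ (η : Fin n → ℝ) (B : Matrix (Fin n) (Fin n) ℂ) (ξ : Fin n → ℝ),
      IsCbBFactorization X η B ξ → PrimalOptimal X (fun j => cbBNorm X * ξ j ^ 2)) ∧
    -- finite optimal dual solutions from self-adjoint Schur factorizations
    (∀ Y : Matrix (Fin n) (Fin n) ℂ, Y.IsHermitian → schurNorm Y = 1 →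
      (Y * X).trace = (cbBNorm X : ℂ) →
      ∀ E S : Matrix (Fin n) (Fin n) ℂ, IsSelfAdjointSchurFactorization Y E S →
        (∃ μ ν : UnitVec n → ℝ, IsSpectralDecomposition (E * posProj S * E) μ ∧
          IsSpectralDecomposition (E * negProj S * E) ν) ∧
        ∀ μ ν : UnitVec n → ℝ, IsSpectralDecomposition (E * posProj S * E) μ →
          IsSpectralDecomposition (E * negProj S * E) ν →
          FiniteSolution μ ν ∧ DualOptimal X μ ν ∧ dualValue X μ ν = cbBNorm X) ∧
    -- norming matrices from finite optimal dual solutions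
    (∀ μ ν : UnitVec n → ℝ, FiniteSolution μ ν → DualOptimal X μ ν →
      ((projSum μ - projSum ν) * X).trace = (cbBNorm X : ℂ) ∧
      (X ≠ 0 → schurNorm (projSum μ - projSum ν) = 1 ∧
        schurNorm (projSum μ + projSum ν) = 1)) := by
  have : NeZero n := ⟨hn.ne'⟩
  obtain ⟨⟨l, hl, hsum⟩, μ₀, ν₀, hfin₀, hf₀, hv₀⟩ := exists_optimal hX
  refine ⟨⟨⟨l, hl, hsum.symm⟩, ?_⟩, ⟨⟨μ₀, ν₀, hf₀, hv₀.symm⟩, ?_⟩,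
    ⟨μ₀, ν₀, hfin₀, hf₀, fun μ' ν' h => hv₀ ▸ h.dualValue_le_cbBNorm hX⟩, ?_,
    fun η B ξ h => h.primalOptimal hX, ?_, ?_⟩
  · rintro v ⟨l', hl', rfl⟩
    exact hl'.cbBNorm_le_sum hX
  · rintro v ⟨μ, ν, h, rfl⟩
    exact h.dualValue_le_cbBNorm hX
  · obtain ⟨B, ξ, h, hB⟩ := exists_isCbBFactorization hX
    exact ⟨B, ξ, h, hB, fun hX0 η' B' ξ' h' => h.unique hX hX0 h'⟩
  · intro Y _ hY1 htr E S h
    refine ⟨?_, fun μ ν hμ hν => ?_⟩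
    · obtain ⟨μ, hμ⟩ := exists_isSpectralDecomposition h.posSemidef_posPart
      obtain ⟨ν, hν⟩ := exists_isSpectralDecomposition h.posSemidef_negPart
      exact ⟨μ, ν, hμ, hν⟩
    · have hf : DualFeasible μ ν := hμ.dualFeasible hν fun j => by
        rw [mul_posProj_add_mul_negProj, ← hY1]
        exact h.diag_le j
      have hv : dualValue X μ ν = cbBNorm X := by
        have := hμ.trace_sub_mul hX hν
        rw [mul_posProj_sub_mul_negProj, ← h.factor, htr] at this
        exact_mod_cast this.symm
      exact ⟨hμ.finiteSolution hν, ⟨hf, fun μ' ν' h' => hv ▸ h'.dualValue_le_cbBNorm hX⟩, hv⟩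
  · intro μ ν hfin hopt
    have htr : ((projSum μ - projSum ν) * X).trace = (cbBNorm X : ℂ) := by
      rw [trace_projSum_sub_mul hX hfin, hopt.dualValue_eq hX]
    refine ⟨htr, fun hX0 => ?_⟩
    have hK := cbBNorm_pos hX hX0
    have hM := projSum_posSemidef hopt.1.nonneg_left hfin.1
    have hN := projSum_posSemidef hopt.1.nonneg_right hfin.2
    have hd := hopt.1.diag_le hfin
    refine ⟨le_antisymm (schurNorm_sub_le hM hN zero_le_one hd)
      (one_le_of_schurNorm_sub_le hK hM.1 hN.1 htr (schurNorm_nonneg _) le_rfl),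
      le_antisymm (schurNorm_le_of_posSemidef (hM.add hN) zero_le_one hd) ?_⟩
    -- The Schur norm of the sum dominates its diagonal, hence also the Schur norm of the
    -- difference, which norms `X`.
    refine one_le_of_schurNorm_sub_le hK hM.1 hN.1 htr (schurNorm_nonneg _)
      (schurNorm_sub_le hM hN (schurNorm_nonneg _) fun j => ?_)
    exact (Complex.re_le_norm _).trans (norm_diag_le_schurNorm _ j)
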